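/- **Theorem (fractional Sobolev inequality with a partial weight).** Let $n,m\ge 0$ be integers and write the points of $\mathbb{R}^{n+m}$ as $(x,\hat x)$ with $x\in\mathbb{R}^n$, $\hat x\in\mathbb{R}^m$. Let $1<p\le q<\infty$, let $p'=\frac{p}{p-1}$, and let $\alpha,\beta\in\mathbb{R}$ satisfy $$\alpha+\beta\ge 0,\qquad \alpha<\frac{m}{p'},\qquad \beta<\frac{m}{q}.$$ For real-valued $\varphi\in C_c^\infty(\mathbb{R}^{n+m})$ and $\gamma>0$ let $(-\Delta)^{\gamma/2}\varphi$ be the function whose Fourier transform is $(2\pi|\xi|)^\gamma\hat\varphi(\xi)$, where $\hat\varphi(\xi)=\int\varphi(y)e^{-2\pi i\langle y,\xi\rangle}\,dy$. Let $W_\alpha^{\gamma,p}(\mathbb{R}^{n+m})$ and $W_\alpha^{1,p}(\mathbb{R}^{n+m})$ denote the completions of $C_c^\infty(\mathbb{R}^{n+m})$ for the norms $\||\hat x|^\alpha(-\Delta)^{\gamma/2}\varphi\|_{L^p(\mathbb{R}^{n+m})}$ and $\||\hat x|^\alpha\nabla\varphi\|_{L^p(\mathbb{R}^{n+m})}$ respectively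 (the second one by convention for the gradient norm), realized as function spaces: for $D=(-\Delta)^{\gamma/2}$ or $D=\nabla$, a function $u$ belongs to the space, with $Du=f$ ($f$ measurable), if there are $\varphi_k\in C_c^\infty(\mathbb{R}^{n+m})$ with $\varphi_k\to u$ almost everywhere and $\||\hat x|^\alpha(D\varphi_k-f)\|_{L^p(\mathbb{R}^{n+m})}\to0$. (i) Let $0<\gamma<n+m$ and $$\frac1q=\frac1p+\frac{\alpha+\beta-\gamma}{n+m}.$$ Then there is a constant $S=S(n,m,p,\alpha,\beta,\gamma)>0$ such that $$\||\hat x|^{-\beta}u\|_{L^q(\mathbb{R}^{n+m})}\le S\,\||\hat x|^{\alpha}(-\Delta)^{\gamma/2}u\|_{L^p(\mathbb{R}^{n+m})}\qquad\text{for all }u\in W_\alpha^{\gamma,p}(\mathbb{R}^{n+m}).$$ (ii) In particular, if $$\frac1q=\frac1p+\frac{\alpha+\beta-1}{n+m},$$ then there is a constant $S=S(n,m,p,\alpha,\beta)>0$ such that $$\||\hat x|^{-\beta}u\|_{L^q(\mathbb{R}^{n+m})}\le S\,\||\hat x|^{\alpha}\nabla u\|_{L^p(\mathbb{R}^{n+m})}\qquad\text{for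 all }u\in W_\alpha^{1,p}(\mathbb{R}^{n+m}).$$ In both cases the function space described above does realize the whole completion: for every sequence $(\varphi_k)$ in $C_c^\infty(\mathbb{R}^{n+m})$ that is Cauchy for the norm there are an element $u$ of the space and $f=Du$ as above with $\||\hat x|^{\alpha}(D\varphi_k-f)\|_{L^p(\mathbb{R}^{n+m})}\to0$ and $\||\hat x|^{-\beta}(\varphi_k-u)\|_{L^q(\mathbb{R}^{n+m})}\to0$. -/

import Mathlib

open MeasureTheory Filter Topology
open scoped ContDiff FourierTransform

noncomputable section

namespace PartialWeight

/-- The Euclidean space `ℝ^{n+m} = ℝ^n × ℝ^m`, whose points are `(x, x̂)` with `x ∈ ℝ^n`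
(the `Sum.inl` coordinates) and `x̂ ∈ ℝ^m` (the `Sum.inr` coordinates). -/
abbrev Space (n m : ℕ) : Type := EuclideanSpace ℝ (Fin n ⊕ Fin m)

/-- The component `x̂ ∈ ℝ^m` of a point `(x, x̂)` of `ℝ^{n+m}`. -/
def hat {n m : ℕ} (X : Space n m) : EuclideanSpace ℝ (Fin m) :=
  WithLp.toLp 2 fun j => X (Sum.inr j)

/-- The partial weight `(x, x̂) ↦ |x̂|^a`. -/
def weight {n m : ℕ} (a : ℝ) (X : Space n m) : ℝ := ‖hat X‖ ^ a

/-- The test functions, `C_c^∞(ℝ^{n+m})` (real-valued). -/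
def IsTest {n m : ℕ} (φ : Space n m → ℝ) : Prop :=
  ContDiff ℝ ∞ φ ∧ HasCompactSupport φ

/-- The fractional Laplacian `(-Δ)^{γ/2} φ`, the Fourier multiplier with symbol `(2π|ξ|)^γ`
(Mathlib's Fourier transform has the kernel `exp(-2πi⟨x, ξ⟩)`). For a real test function `φ` and
`γ > 0` the integrals converge absolutely and the inverse transform is real-valued, so that
the real part only changes the codomain. -/
def fracLaplacian {n m : ℕ} (γ : ℝ) (φ : Space n m → ℝ) (X : Space n m) : ℝ :=
  (𝓕⁻ (fun ξ : Space n m =>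
    (((2 * Real.pi * ‖ξ‖) ^ γ : ℝ) : ℂ) * 𝓕 (fun Y : Space n m => (φ Y : ℂ)) ξ) X).re

/-- The weighted seminorm distance `‖|x̂|^a (f - g)‖_{L^p(ℝ^{n+m})}`. -/
def wdist {n m : ℕ} {F : Type*} [NormedAddCommGroup F] [NormedSpace ℝ F]
    (a p : ℝ) (f g : Space n m → F) : ENNReal :=
  eLpNorm (fun X => weight a X • (f X - g X)) (ENNReal.ofReal p) volume

/-- A sequence of test functions that is Cauchy for the norm `φ ↦ ‖|x̂|^a D φ‖_{L^p}`. -/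
def IsCauchySeq {n m : ℕ} {F : Type*} [NormedAddCommGroup F] [NormedSpace ℝ F]
    (D : (Space n m → ℝ) → Space n m → F) (a p : ℝ) (φ : ℕ → Space n m → ℝ) : Prop :=
  (∀ k, IsTest (φ k)) ∧
    Tendsto (fun jk : ℕ × ℕ => wdist a p (D (φ jk.1)) (D (φ jk.2))) atTop (𝓝 0)

/-- `u` is an element of the completion of `C_c^∞(ℝ^{n+m})` for the norm
`φ ↦ ‖|x̂|^a D φ‖_{L^p}`, and `f` is the value `D u` of the operator `D`, extended to the
completion by continuity: there are test functions `φ k` with `φ k → u` almost everywhere and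
`|x̂|^a D (φ k) → |x̂|^a f` in `L^p`. -/
def InCompletion {n m : ℕ} {F : Type*} [NormedAddCommGroup F] [NormedSpace ℝ F]
    (D : (Space n m → ℝ) → Space n m → F) (a p : ℝ)
    (u : Space n m → ℝ) (f : Space n m → F) : Prop :=
  AEStronglyMeasurable f volume ∧
    ∃ φ : ℕ → Space n m → ℝ, (∀ k, IsTest (φ k)) ∧
      (∀ᵐ X, Tendsto (fun k => φ k X) atTop (𝓝 (u X))) ∧
      Tendsto (fun k => wdist a p (D (φ k)) f) atTop (𝓝 0)

/-- `u ∈ W_α^{γ,p}(ℝ^{n+m})` with `(-Δ)^{γ/2} u = f`. -/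
def InFracSobolev {n m : ℕ} (γ α p : ℝ) (u f : Space n m → ℝ) : Prop :=
  InCompletion (fracLaplacian γ) α p u f

/-- `u ∈ W_α^{1,p}(ℝ^{n+m})` with `∇u = G`. -/
def InGradSobolev {n m : ℕ} (α p : ℝ) (u : Space n m → ℝ) (G : Space n m → Space n m) : Prop :=
  InCompletion gradient α p u G

end PartialWeight

end

/-!
A test function `φ` is dominated pointwise by a constant times the Riesz potential of order `γ` of
`|(-Δ)^{γ/2} φ|`, resp. of order one of `|∇φ|`. For the gradient one integrates `φ` along rays and
passes to polar coordinates; for the fractional Laplacian one writes the symbol `(2π|ξ|)^(-γ)` as a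
superposition of Gaussians, which makes the argument one about absolutely convergent integrals.

It remains to bound the Riesz potential from `|x̂|^α`-weighted `L^p` to `|x̂|^{-β}`-weighted `L^q`.
By Minkowski's inequality (this is where `p ≤ q` enters) the bound splits into one in `x` with `x̂`
frozen and one in `x̂`. The first is the Hardy-Littlewood-Sobolev inequality if `p < q` and Young's
inequality if `p = q`; what remains of the kernel in `x̂` is a Riesz kernel, to which the
Stein-Weiss inequality applies. In the latter, Schur's test with power weights handles the region
where the norms of the two variables are not comparable; on the remaining one the weights can be
traded for one another.
-/

noncomputable section

open scoped ENNReal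

namespace PartialWeight

section Minkowski

variable {X Y : Type*} [MeasurableSpace X] [MeasurableSpace Y] {μ : Measure X} {ν : Measure Y}

lemma eLpNorm'_rpow_eq_lintegral {p : ℝ} (hp : 0 < p) (f : X → ℝ≥0∞) :
    eLpNorm' f p μ ^ p = ∫⁻ x, f x ^ p ∂μ :=
  (lintegral_rpow_enorm_eq_rpow_eLpNorm' hp).symm

lemma eLpNorm'_const_mul {p : ℝ} (hp : 0 < p) (c : ℝ≥0∞) {f : X → ℝ≥0∞} (hf : Measurable f) :
    eLpNorm' (fun x => c * f x) p μ = c * eLpNorm' f p μ := by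
  simp_rw [eLpNorm'_eq_lintegral_enorm, enorm_eq_self, ENNReal.mul_rpow_of_nonneg _ _ hp.le]
  rw [lintegral_const_mul _ (hf.pow_const p), ENNReal.mul_rpow_of_nonneg _ _ (by positivity),
    ← ENNReal.rpow_mul, mul_one_div_cancel hp.ne', ENNReal.rpow_one]

lemma eLpNorm'_const_mul_of_ne_top {p : ℝ} (hp : 0 < p) {c : ℝ≥0∞} (hc : c ≠ ⊤) (f : X → ℝ≥0∞) :
    eLpNorm' (fun x => c * f x) p μ = c * eLpNorm' f p μ := by
  simp_rw [eLpNorm'_eq_lintegral_enorm, enorm_eq_self, ENNReal.mul_rpow_of_nonneg _ _ hp.le]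
  rw [lintegral_const_mul' _ _ (by finiteness), ENNReal.mul_rpow_of_nonneg _ _ (by positivity),
    ← ENNReal.rpow_mul, mul_one_div_cancel hp.ne', ENNReal.rpow_one]

lemma eLpNorm'_comp_measurePreserving {p : ℝ} {T : X → Y} (hT : MeasurePreserving T μ ν)
    {f : Y → ℝ≥0∞} (hf : Measurable f) : eLpNorm' (fun x => f (T x)) p μ = eLpNorm' f p ν := by
  simp_rw [eLpNorm'_eq_lintegral_enorm, enorm_eq_self]
  rw [hT.lintegral_comp (hf.pow_const p)]

lemma lintegral_mul_rpow_sub_one_le {r : ℝ} (hr : 1 < r) {g H : X → ℝ≥0∞} (hg : Measurable g)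
    (hH : Measurable H) :
    ∫⁻ x, g x * H x ^ (r - 1) ∂μ ≤ eLpNorm' g r μ * eLpNorm' H r μ ^ (r - 1) := by
  have hr1 : 0 < r - 1 := by linarith
  have hexp : r / (r - 1) * (r - 1) = r := div_mul_cancel₀ _ hr1.ne'
  calc ∫⁻ x, g x * H x ^ (r - 1) ∂μ
      ≤ eLpNorm' g r μ * eLpNorm' (fun x => ‖H x‖ₑ ^ (r - 1)) (r / (r - 1)) μ :=
        ENNReal.lintegral_mul_le_Lp_mul_Lq μ (.conjExponent hr) hg.aemeasurable
          (hH.pow_const _).aemeasurable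
    _ = eLpNorm' g r μ * eLpNorm' H r μ ^ (r - 1) := by
        rw [eLpNorm'_enorm_rpow _ _ _ hr1, hexp]

/-- The duality step of Minkowski's integral inequality; finiteness of the norm is what allows
the cancellation of the factor `‖H‖_r ^ (r - 1)`. -/
lemma eLpNorm'_le_lintegral_eLpNorm' [SFinite μ] [SFinite ν] {r : ℝ} (hr : 1 < r)
    {F : X → Y → ℝ≥0∞} (hF : Measurable (Function.uncurry F)) {H : X → ℝ≥0∞} (hH : Measurable H)
    (hle : ∀ x, H x ≤ ∫⁻ y, F x y ∂ν) (hfin : eLpNorm' H r μ ≠ ⊤) :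
    eLpNorm' H r μ ≤ ∫⁻ y, eLpNorm' (fun x => F x y) r μ ∂ν := by
  have hr1 : 0 ≤ r - 1 := by linarith
  rcases eq_or_ne (eLpNorm' H r μ) 0 with h0 | h0
  · simp [h0]
  have hsplit : ∀ u : ℝ≥0∞, u ^ r = u * u ^ (r - 1) := fun u => by
    nth_rw 2 [← ENNReal.rpow_one u]
    rw [← ENNReal.rpow_add_of_nonneg _ _ zero_le_one hr1, add_sub_cancel]
  have hpow : eLpNorm' H r μ ^ (r - 1) ≠ ⊤ := ENNReal.rpow_ne_top_of_nonneg hr1 hfin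
  refine (ENNReal.mul_le_mul_iff_left (by simp [h0, hfin]) hpow).1 ?_
  calc eLpNorm' H r μ * eLpNorm' H r μ ^ (r - 1)
      = ∫⁻ x, H x * H x ^ (r - 1) ∂μ := by
        rw [← hsplit, eLpNorm'_rpow_eq_lintegral (by linarith)]
        simp_rw [hsplit]
    _ ≤ ∫⁻ x, ∫⁻ y, F x y * H x ^ (r - 1) ∂ν ∂μ := by
        refine lintegral_mono fun x => ?_
        rw [lintegral_mul_const _ hF.of_uncurry_left]
        gcongr
        exact hle x
    _ = ∫⁻ y, ∫⁻ x, F x y * H x ^ (r - 1) ∂μ ∂ν :=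
        lintegral_lintegral_swap
          (hF.mul ((hH.comp measurable_fst).pow_const (r - 1))).aemeasurable
    _ ≤ ∫⁻ y, eLpNorm' (fun x => F x y) r μ * eLpNorm' H r μ ^ (r - 1) ∂ν :=
        lintegral_mono fun _ => lintegral_mul_rpow_sub_one_le hr hF.of_uncurry_right hH
    _ = (∫⁻ y, eLpNorm' (fun x => F x y) r μ ∂ν) * eLpNorm' H r μ ^ (r - 1) :=
        lintegral_mul_const' _ _ hpow

lemma eLpNorm'_indicator_min_ne_top {r : ℝ} (hr : 0 < r) {s : Set X} (hs : MeasurableSet s)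
    (hμ : μ s ≠ ⊤) {c : ℝ≥0∞} (hc : c ≠ ⊤) (G : X → ℝ≥0∞) :
    eLpNorm' (s.indicator fun x => min (G x) c) r μ ≠ ⊤ := by
  have hle : ∀ x, s.indicator (fun x => min (G x) c) x ^ r ≤ s.indicator (fun _ => c ^ r) x := by
    intro x
    by_cases hx : x ∈ s
    · simp only [Set.indicator_of_mem hx]
      gcongr
      exact min_le_right _ _
    · simp [hx, hr]
  refine ENNReal.rpow_ne_top_of_nonneg (by positivity) (ne_top_of_le_ne_top ?_ (lintegral_mono hle))
  rw [lintegral_indicator_const hs]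
  finiteness

lemma exists_monotone_iSup_eq_eLpNorm'_ne_top [SigmaFinite μ] {r : ℝ} (hr : 0 < r)
    {G : X → ℝ≥0∞} (hG : Measurable G) :
    ∃ H : ℕ → X → ℝ≥0∞, (∀ k, Measurable (H k)) ∧ Monotone H ∧ (∀ x, ⨆ k, H k x = G x) ∧
      ∀ k, eLpNorm' (H k) r μ ≠ ⊤ := by
  refine ⟨fun k => (spanningSets μ k).indicator fun x => min (G x) k,
    fun k => (hG.min measurable_const).indicator (measurableSet_spanningSets μ k),
    fun i j hij x => ?_, fun x => ?_, fun k => eLpNorm'_indicator_min_ne_top hr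
      (measurableSet_spanningSets μ k) (measure_spanningSets_lt_top μ k).ne (by simp) G⟩
  · refine (Set.indicator_le_indicator_of_subset (monotone_spanningSets μ hij) (by simp) x).trans
      (Set.indicator_le_indicator ?_)
    gcongr
  · refine le_antisymm (iSup_le fun k => (Set.indicator_le_self _ _ x).trans (min_le_left _ _))
      (le_of_forall_lt fun c hc => ?_)
    obtain ⟨k, hk⟩ := ENNReal.exists_nat_gt hc.ne_top
    obtain ⟨j, hj⟩ := Set.mem_iUnion.1 ((iUnion_spanningSets μ).symm ▸ Set.mem_univ x)
    refine lt_of_lt_of_le ?_ (le_iSup _ (max k j))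
    beta_reduce
    rw [Set.indicator_of_mem (monotone_spanningSets μ (le_max_right _ _) hj)]
    exact lt_min hc (hk.trans_le (mod_cast le_max_left _ _))

lemma eLpNorm'_iSup {r : ℝ} (hr : 0 < r) {H : ℕ → X → ℝ≥0∞} (hH : ∀ k, Measurable (H k))
    (hmono : Monotone H) :
    eLpNorm' (fun x => ⨆ k, H k x) r μ = ⨆ k, eLpNorm' (H k) r μ := by
  have hrpow : ∀ x, (⨆ k, H k x) ^ r = ⨆ k, H k x ^ r := fun x =>
    (ENNReal.orderIsoRpow r hr).map_iSup _
  simp_rw [eLpNorm'_eq_lintegral_enorm, enorm_eq_self, hrpow]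
  rw [lintegral_iSup (fun k => (hH k).pow_const r)
    fun i j hij x => ENNReal.rpow_le_rpow (hmono hij x) hr.le]
  exact (ENNReal.orderIsoRpow (1 / r) (by positivity)).map_iSup _

theorem eLpNorm'_lintegral_le [SigmaFinite μ] [SFinite ν] {r : ℝ} (hr : 1 ≤ r) {F : X → Y → ℝ≥0∞}
    (hF : Measurable (Function.uncurry F)) :
    eLpNorm' (fun x => ∫⁻ y, F x y ∂ν) r μ ≤ ∫⁻ y, eLpNorm' (fun x => F x y) r μ ∂ν := by
  rcases hr.eq_or_lt with rfl | hr
  · simpa [eLpNorm'_eq_lintegral_enorm] using (lintegral_lintegral_swap hF.aemeasurable).le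
  obtain ⟨H, hH, hmono, hsup, hfin⟩ := exists_monotone_iSup_eq_eLpNorm'_ne_top (μ := μ)
    (by linarith : 0 < r) (hF.lintegral_prod_right (ν := ν))
  rw [funext fun x => (hsup x).symm, eLpNorm'_iSup (by linarith) hH hmono]
  refine iSup_le fun k => eLpNorm'_le_lintegral_eLpNorm' hr hF (hH k) (fun x => ?_) (hfin k)
  exact (le_iSup (fun k => H k x) k).trans_eq (hsup x)

theorem eLpNorm'_eLpNorm'_le_swap [SigmaFinite μ] [SFinite ν] {p q : ℝ} (hp : 0 < p) (hpq : p ≤ q)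
    {F : X → Y → ℝ≥0∞} (hF : Measurable (Function.uncurry F)) :
    eLpNorm' (fun x => eLpNorm' (F x) p ν) q μ ≤
      eLpNorm' (fun y => eLpNorm' (fun x => F x y) q μ) p ν := by
  have hq : q / p * p = q := div_mul_cancel₀ _ hp.ne'
  calc eLpNorm' (fun x => eLpNorm' (F x) p ν) q μ
      = eLpNorm' (fun x => ∫⁻ y, F x y ^ p ∂ν) (q / p) μ ^ (1 / p) := by
        rw [← mul_one_div, ← eLpNorm'_enorm_rpow _ _ _ (by positivity)]
        rfl
    _ ≤ (∫⁻ y, eLpNorm' (fun x => F x y ^ p) (q / p) μ ∂ν) ^ (1 / p) := by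
        gcongr
        exact eLpNorm'_lintegral_le ((one_le_div hp).2 hpq) (hF.pow_const p)
    _ = (∫⁻ y, eLpNorm' (fun x => F x y) q μ ^ p ∂ν) ^ (1 / p) := by
        congr 2 with y
        nth_rw 2 [← hq]
        exact eLpNorm'_enorm_rpow (fun x => F x y) _ _ hp
    _ = eLpNorm' (fun y => eLpNorm' (fun x => F x y) q μ) p ν := rfl

end Minkowski

section KernelBound

variable {X Y : Type*} [MeasurableSpace X] [MeasurableSpace Y] {μ : Measure X} {ν : Measure Y}
  {p q : ℝ} {k : X → Y → ℝ≥0∞} {C : ℝ≥0∞}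

/-- The integral operator with the nonnegative kernel `k` has norm at most `C` from `L ^ p` to
`L ^ q`; testing it on nonnegative functions is enough. -/
def KernelBound (μ : Measure X) (ν : Measure Y) (p q : ℝ) (k : X → Y → ℝ≥0∞) (C : ℝ≥0∞) : Prop :=
  ∀ f : Y → ℝ≥0∞, Measurable f →
    eLpNorm' (fun x => ∫⁻ y, k x y * f y ∂ν) q μ ≤ C * eLpNorm' f p ν

lemma KernelBound.of_ae_le_const_mul (hq : 0 < q) (h : KernelBound μ ν p q k C) {c : ℝ≥0∞}
    (hc : c ≠ ⊤) {k' : X → Y → ℝ≥0∞} (hk : ∀ᵐ x ∂μ, ∀ᵐ y ∂ν, k' x y ≤ c * k x y) :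
    KernelBound μ ν p q k' (c * C) := fun f hf =>
  calc eLpNorm' (fun x => ∫⁻ y, k' x y * f y ∂ν) q μ
      ≤ eLpNorm' (fun x => c * ∫⁻ y, k x y * f y ∂ν) q μ := by
        refine eLpNorm'_mono_enorm_ae hq.le ?_
        filter_upwards [hk] with x hx
        simp_rw [enorm_eq_self]
        rw [← lintegral_const_mul' _ _ hc]
        refine lintegral_mono_ae ?_
        filter_upwards [hx] with y hy
        rw [← mul_assoc]
        gcongr
    _ = c * eLpNorm' (fun x => ∫⁻ y, k x y * f y ∂ν) q μ := eLpNorm'_const_mul_of_ne_top hq hc _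
    _ ≤ c * C * eLpNorm' f p ν := by
        rw [mul_assoc]
        gcongr
        exact h f hf

lemma KernelBound.add [SFinite ν] (hq : 1 ≤ q) (hk : Measurable (Function.uncurry k))
    (h : KernelBound μ ν p q k C) {k' : X → Y → ℝ≥0∞} {C' : ℝ≥0∞}
    (hk' : Measurable (Function.uncurry k')) (h' : KernelBound μ ν p q k' C') :
    KernelBound μ ν p q (fun x y => k x y + k' x y) (C + C') := fun f hf => by
  have hkf : Measurable fun z : X × Y => k z.1 z.2 * f z.2 := hk.mul (hf.comp measurable_snd)
  have hkf' : Measurable fun z : X × Y => k' z.1 z.2 * f z.2 := hk'.mul (hf.comp measurable_snd)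
  have hsum : (fun x => ∫⁻ y, (k x y + k' x y) * f y ∂ν) =
      (fun x => ∫⁻ y, k x y * f y ∂ν) + fun x => ∫⁻ y, k' x y * f y ∂ν := by
    funext x
    simp_rw [add_mul]
    exact lintegral_add_left (hkf.comp measurable_prodMk_left) _
  rw [hsum, add_mul]
  exact (eLpNorm'_add_le hkf.lintegral_prod_right'.aestronglyMeasurable
    hkf'.lintegral_prod_right'.aestronglyMeasurable hq).trans (add_le_add (h f hf) (h' f hf))

/-- Schur's test, in the form in which the kernel is split into two factors: Hölder's inequality
takes care of the first one and Minkowski's of the second. -/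
theorem KernelBound.of_mul [SigmaFinite μ] [SFinite ν] {p' : ℝ}
    (hp : p.HolderConjugate p') (hpq : p ≤ q) {K₁ K₂ : X → Y → ℝ≥0∞}
    (hK₁ : Measurable (Function.uncurry K₁)) (hK₂ : Measurable (Function.uncurry K₂))
    {A : X → ℝ≥0∞} (hA : Measurable A) (h₁ : ∀ᵐ x ∂μ, eLpNorm' (K₁ x) p' ν ≤ A x)
    (h₂ : ∀ᵐ y ∂ν, eLpNorm' (fun x => A x * K₂ x y) q μ ≤ C) :
    KernelBound μ ν p q (fun x y => K₁ x y * K₂ x y) C := by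
  have hp0 : 0 < p := hp.pos
  have hq0 : 0 < q := hp0.trans_le hpq
  have hAK : Measurable (Function.uncurry fun x y => A x * K₂ x y) :=
    (hA.comp measurable_fst).mul hK₂
  intro f hf
  calc eLpNorm' (fun x => ∫⁻ y, K₁ x y * K₂ x y * f y ∂ν) q μ
      ≤ eLpNorm' (fun x => eLpNorm' (fun y => A x * K₂ x y * f y) p ν) q μ := by
        refine eLpNorm'_mono_enorm_ae hq0.le ?_
        filter_upwards [h₁] with x hx
        have hKf : Measurable fun y => K₂ x y * f y := hK₂.of_uncurry_left.mul hf
        simp_rw [mul_assoc, enorm_eq_self]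
        rw [eLpNorm'_const_mul hp0 _ hKf]
        exact (ENNReal.lintegral_mul_le_Lp_mul_Lq ν hp.symm hK₁.of_uncurry_left.aemeasurable
          hKf.aemeasurable).trans (mul_le_mul_left hx _)
    _ ≤ eLpNorm' (fun y => eLpNorm' (fun x => A x * K₂ x y * f y) q μ) p ν :=
        eLpNorm'_eLpNorm'_le_swap hp0 hpq (hAK.mul (hf.comp measurable_snd))
    _ ≤ eLpNorm' (fun y => C * f y) p ν := by
        refine eLpNorm'_mono_enorm_ae hp0.le ?_
        filter_upwards [h₂] with y hy
        simp_rw [enorm_eq_self, mul_comm _ (f y)]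
        rw [eLpNorm'_const_mul hq0 _ hAK.of_uncurry_right]
        gcongr
    _ = C * eLpNorm' f p ν := eLpNorm'_const_mul hp0 C hf

lemma KernelBound.of_lintegral_le [SigmaFinite μ] [SFinite ν] {p' : ℝ} (hp : p.HolderConjugate p')
    {k₁ k₂ : X → Y → ℝ≥0∞} (hk₁ : Measurable (Function.uncurry k₁))
    (hk₂ : Measurable (Function.uncurry k₂)) (h₁ : ∀ᵐ x ∂μ, ∫⁻ y, k₁ x y ∂ν ≤ C)
    (h₂ : ∀ᵐ y ∂ν, ∫⁻ x, k₂ x y ∂μ ≤ C) :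
    KernelBound μ ν p p (fun x y => k₁ x y ^ (1 / p') * k₂ x y ^ (1 / p)) C := by
  have hinv : 1 / p' + 1 / p = 1 := by simpa [add_comm] using hp.inv_add_inv_eq_one
  have hpow : ∀ {r : ℝ}, 0 < r → ∀ a : ℝ≥0∞, (a ^ (1 / r)) ^ r = a := fun hr a => by
    rw [← ENNReal.rpow_mul, one_div_mul_cancel hr.ne', ENNReal.rpow_one]
  refine .of_mul hp le_rfl (hk₁.pow_const _) (hk₂.pow_const _) (A := fun _ => C ^ (1 / p'))
    measurable_const ?_ ?_
  · filter_upwards [h₁] with x hx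
    simp_rw [eLpNorm'_eq_lintegral_enorm, enorm_eq_self, hpow hp.symm.pos]
    exact ENNReal.rpow_le_rpow hx (one_div_nonneg.2 hp.symm.nonneg)
  · filter_upwards [h₂] with y hy
    rw [eLpNorm'_const_mul hp.pos _ (hk₂.of_uncurry_right.pow_const _)]
    calc C ^ (1 / p') * eLpNorm' (fun x => k₂ x y ^ (1 / p)) p μ
        ≤ C ^ (1 / p') * C ^ (1 / p) := by
          simp_rw [eLpNorm'_eq_lintegral_enorm, enorm_eq_self, hpow hp.pos]
          gcongr
          exact one_div_nonneg.2 hp.nonneg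
      _ = C := by
          rw [← ENNReal.rpow_add_of_nonneg _ _ (one_div_nonneg.2 hp.symm.nonneg)
            (one_div_nonneg.2 hp.nonneg), hinv, ENNReal.rpow_one]

end KernelBound

lemma ennreal_rpow_le_rpow_of_nonpos {x y : ℝ≥0∞} {z : ℝ} (hz : z ≤ 0) (h : x ≤ y) :
    y ^ z ≤ x ^ z := by
  rw [← neg_neg z, ENNReal.rpow_neg, ENNReal.rpow_neg x]
  exact ENNReal.inv_le_inv.2 (ENNReal.rpow_le_rpow h (by linarith))

section PowerIntegrals

variable {E : Type*} [NormedAddCommGroup E] [NormedSpace ℝ E]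

lemma enorm_smul_of_pos {r : ℝ} (hr : 0 < r) (x : E) : ‖r • x‖ₑ = ENNReal.ofReal r * ‖x‖ₑ := by
  rw [enorm_smul, Real.enorm_of_nonneg hr.le]

variable [FiniteDimensional ℝ E] [MeasurableSpace E] [BorelSpace E] (μ : Measure E)
  [μ.IsAddHaarMeasure]

lemma lintegral_comp_smul {r : ℝ} (hr : 0 < r) (f : E → ℝ≥0∞) :
    ∫⁻ x, f x ∂μ = ENNReal.ofReal r ^ (Module.finrank ℝ E : ℝ) * ∫⁻ x, f (r • x) ∂μ := by
  have hmap : ∫⁻ x, f (r • x) ∂μ = ∫⁻ x, f x ∂(Measure.map (r • ·) μ) :=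
    (lintegral_map_equiv f (Homeomorph.smulOfNeZero r hr.ne').toMeasurableEquiv).symm
  rw [hmap, Measure.map_addHaar_smul μ hr.ne', lintegral_smul_measure, smul_eq_mul, ← mul_assoc,
    abs_of_nonneg (by positivity), ENNReal.rpow_natCast, ← ENNReal.ofReal_pow hr.le,
    ← ENNReal.ofReal_mul (by positivity), mul_inv_cancel₀ (by positivity), ENNReal.ofReal_one,
    one_mul]

lemma lintegral_enorm_of_homogeneous {Φ Ψ : ℝ≥0∞ → ℝ≥0∞} {a : ℝ} {R : ℝ≥0∞} (hR : R ≠ 0)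
    (hR' : R ≠ ⊤) (h : ∀ t ≠ ⊤, Ψ (R * t) = R ^ a * Φ t) :
    ∫⁻ x, Ψ ‖x‖ₑ ∂μ = R ^ (Module.finrank ℝ E + a) * ∫⁻ x, Φ ‖x‖ₑ ∂μ := by
  have hr : 0 < R.toReal := ENNReal.toReal_pos hR hR'
  rw [lintegral_comp_smul μ hr, ENNReal.rpow_add _ _ hR hR', mul_assoc,
    ← lintegral_const_mul' _ _ (ENNReal.rpow_ne_top_of_ne_zero hR hR')]
  simp_rw [enorm_smul_of_pos hr, ENNReal.ofReal_toReal hR', h _ enorm_ne_top]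

lemma setLIntegral_enorm_lt_one_ne_top [Nontrivial E] {a : ℝ}
    (ha : -(Module.finrank ℝ E : ℝ) < a) : ∫⁻ x in {x | ‖x‖ₑ < 1}, ‖x‖ₑ ^ a ∂μ ≠ ⊤ := by
  have hball : {x : E | ‖x‖ₑ < 1} = Metric.ball 0 1 := by
    ext x
    simp [← ofReal_norm]
  have hint : IntegrableOn (fun x : E => ‖x‖ ^ a) (Metric.ball 0 1) μ :=
    integrableOn_ball_of_norm_le_rpow Module.finrank_pos (C := 1) (α := -a) (by linarith)
      (.of_forall fun x => by rw [neg_neg, one_mul, Real.norm_of_nonneg (by positivity)])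
      (measurable_norm.pow_const a).aestronglyMeasurable
  rw [hball]
  refine ((lintegral_congr_ae ?_).trans_lt hint.2).ne
  filter_upwards [ae_restrict_of_ae (Measure.ae_ne μ (0 : E))] with x hx
  rw [Real.enorm_of_nonneg (by positivity), ← ENNReal.ofReal_rpow_of_pos (norm_pos_iff.2 hx),
    ofReal_norm]

lemma lintegral_enorm_add_one_rpow_ne_top {a : ℝ} (ha : a < -(Module.finrank ℝ E : ℝ)) :
    ∫⁻ x, (‖x‖ₑ + 1) ^ a ∂μ ≠ ⊤ := by
  refine ((lintegral_congr fun x => ?_).trans_lt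
    (finite_integral_one_add_norm (μ := μ) (r := -a) (by linarith))).ne
  rw [neg_neg, ← ENNReal.ofReal_rpow_of_pos (by positivity), ENNReal.ofReal_add zero_le_one
    (norm_nonneg _), ofReal_norm, ENNReal.ofReal_one, add_comm]

lemma setLIntegral_one_le_enorm_ne_top {a : ℝ} (ha : a < -(Module.finrank ℝ E : ℝ)) :
    ∫⁻ x in {x | 1 ≤ ‖x‖ₑ}, ‖x‖ₑ ^ a ∂μ ≠ ⊤ := by
  have ha0 : a ≤ 0 := ha.le.trans (by simp)
  have hm : MeasurableSet {x : E | 1 ≤ ‖x‖ₑ} := measurableSet_le measurable_const measurable_enorm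
  refine ne_top_of_le_ne_top ?_ ((setLIntegral_mono' hm fun x hx => ?_).trans
    (setLIntegral_le_lintegral _ fun x : E => 2 ^ (-a) * (‖x‖ₑ + 1) ^ a))
  · rw [lintegral_const_mul' _ _ (by finiteness)]
    exact ENNReal.mul_ne_top (by finiteness) (lintegral_enorm_add_one_rpow_ne_top μ ha)
  · have hx2 : ‖x‖ₑ + 1 ≤ 2 * ‖x‖ₑ := by
      rw [two_mul]
      gcongr
      exact hx
    calc ‖x‖ₑ ^ a = 2 ^ (-a) * (2 * ‖x‖ₑ) ^ a := by
          rw [ENNReal.mul_rpow_of_ne_top (by simp) (by simp), ← mul_assoc,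
            ← ENNReal.rpow_add _ _ (by simp) (by simp), neg_add_cancel, ENNReal.rpow_zero, one_mul]
      _ ≤ 2 ^ (-a) * (‖x‖ₑ + 1) ^ a :=
          mul_le_mul_right (ennreal_rpow_le_rpow_of_nonpos ha0 hx2) _

lemma exists_setLIntegral_enorm_lt_eq [Nontrivial E] {a : ℝ}
    (ha : -(Module.finrank ℝ E : ℝ) < a) :
    ∃ C : ℝ≥0∞, C ≠ ⊤ ∧ ∀ R : ℝ≥0∞, R ≠ 0 → R ≠ ⊤ →
      ∫⁻ x in {x | ‖x‖ₑ < R}, ‖x‖ₑ ^ a ∂μ = C * R ^ (Module.finrank ℝ E + a) := by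
  refine ⟨_, setLIntegral_enorm_lt_one_ne_top μ ha, fun R hR hR' => ?_⟩
  rw [← lintegral_indicator (measurableSet_lt measurable_enorm measurable_const),
    ← lintegral_indicator (measurableSet_lt measurable_enorm measurable_const), mul_comm]
  refine lintegral_enorm_of_homogeneous μ (Φ := (Set.Iio 1).indicator fun t => t ^ a)
    (Ψ := (Set.Iio R).indicator fun t => t ^ a) hR hR' fun t ht => ?_
  have hmem : R * t ∈ Set.Iio R ↔ t ∈ Set.Iio 1 := by
    simpa using ENNReal.mul_lt_mul_iff_right (b := t) (c := 1) hR hR'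
  simp only [Set.indicator_apply, hmem, mul_ite, mul_zero, ENNReal.mul_rpow_of_ne_top hR' ht]

lemma exists_setLIntegral_le_enorm_eq {a : ℝ} (ha : a < -(Module.finrank ℝ E : ℝ)) :
    ∃ C : ℝ≥0∞, C ≠ ⊤ ∧ ∀ R : ℝ≥0∞, R ≠ 0 → R ≠ ⊤ →
      ∫⁻ x in {x | R ≤ ‖x‖ₑ}, ‖x‖ₑ ^ a ∂μ = C * R ^ (Module.finrank ℝ E + a) := by
  refine ⟨_, setLIntegral_one_le_enorm_ne_top μ ha, fun R hR hR' => ?_⟩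
  rw [← lintegral_indicator (measurableSet_le measurable_const measurable_enorm),
    ← lintegral_indicator (measurableSet_le measurable_const measurable_enorm), mul_comm]
  refine lintegral_enorm_of_homogeneous μ (Φ := (Set.Ici 1).indicator fun t => t ^ a)
    (Ψ := (Set.Ici R).indicator fun t => t ^ a) hR hR' fun t ht => ?_
  have hmem : R * t ∈ Set.Ici R ↔ t ∈ Set.Ici 1 := by
    simpa using ENNReal.mul_le_mul_iff_right (b := 1) (c := t) hR hR'
  simp only [Set.indicator_apply, hmem, mul_ite, mul_zero, ENNReal.mul_rpow_of_ne_top hR' ht]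

lemma exists_lintegral_enorm_add_rpow_eq {a : ℝ} (ha : a < -(Module.finrank ℝ E : ℝ)) :
    ∃ C : ℝ≥0∞, C ≠ ⊤ ∧ ∀ R : ℝ≥0∞, R ≠ 0 → R ≠ ⊤ →
      ∫⁻ x, (‖x‖ₑ + R) ^ a ∂μ = C * R ^ (Module.finrank ℝ E + a) := by
  refine ⟨_, lintegral_enorm_add_one_rpow_ne_top μ ha, fun R hR hR' => ?_⟩
  rw [mul_comm]
  refine lintegral_enorm_of_homogeneous μ (Φ := fun t => (t + 1) ^ a)
    (Ψ := fun t => (t + R) ^ a) hR hR' fun t ht => ?_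
  rw [← ENNReal.mul_rpow_of_ne_top hR' (by finiteness), mul_add, mul_one]

end PowerIntegrals

section LayerCake

variable {X Y : Type*} [MeasurableSpace X] [MeasurableSpace Y] {μ : Measure X} {ν : Measure Y}

lemma lintegral_rpow_eq_lintegral_measure_lt {f : X → ℝ≥0∞} (hf : AEMeasurable f μ) {c : ℝ}
    (hc : 0 < c) :
    ∫⁻ x, f x ^ c ∂μ = ENNReal.ofReal c *
      ∫⁻ l in Set.Ioi (0 : ℝ), μ {x | ENNReal.ofReal l < f x} * ENNReal.ofReal (l ^ (c - 1)) := by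
  by_cases htop : μ {x | f x = ⊤} = 0
  · have hfin : ∀ᵐ x ∂μ, f x ≠ ⊤ := by simpa [ae_iff] using htop
    calc ∫⁻ x, f x ^ c ∂μ = ∫⁻ x, ENNReal.ofReal ((f x).toReal ^ c) ∂μ := by
          refine lintegral_congr_ae (hfin.mono fun x hx => ?_)
          beta_reduce
          rw [← ENNReal.ofReal_rpow_of_nonneg ENNReal.toReal_nonneg hc.le, ENNReal.ofReal_toReal hx]
      _ = _ := lintegral_rpow_eq_lintegral_meas_lt_mul μ (.of_forall fun _ => ENNReal.toReal_nonneg)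
          hf.ennreal_toReal hc
      _ = _ := by
          congr 1
          refine setLIntegral_congr_fun measurableSet_Ioi fun l hl => ?_
          congr 1
          refine measure_congr (hfin.mono fun x hx => ?_)
          exact propext (ENNReal.ofReal_lt_iff_lt_toReal (le_of_lt hl) hx).symm
  · have hlhs : ∫⁻ x, f x ^ c ∂μ = ⊤ := by
      refine lintegral_eq_top_of_measure_eq_top_ne_zero (hf.pow_const c) ?_
      simpa [ENNReal.rpow_eq_top_iff_of_pos hc] using htop
    have hpow : ∫⁻ l in Set.Ioi (0 : ℝ), ENNReal.ofReal (l ^ (c - 1)) = ⊤ := by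
      by_contra h
      refine not_integrableOn_Ioi_rpow (c - 1)
        ((lintegral_ofReal_ne_top_iff_integrable ?_ ?_).1 h)
      · exact (measurable_id.pow_const _).aestronglyMeasurable
      · filter_upwards [ae_restrict_mem measurableSet_Ioi] with l hl
        exact Real.rpow_nonneg (le_of_lt hl) _
    refine hlhs.trans (eq_top_iff.2 ?_).symm
    calc ⊤ = ENNReal.ofReal c * ∫⁻ l in Set.Ioi (0 : ℝ),
          μ {x | f x = ⊤} * ENNReal.ofReal (l ^ (c - 1)) := by
          rw [lintegral_const_mul _ (by fun_prop), hpow, ENNReal.mul_top htop,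
            ENNReal.mul_top (by simpa using hc)]
      _ ≤ _ := by
          gcongr with l x
          rintro (hx : f x = ⊤)
          simp [hx]

lemma measure_lt_mul_rpow_le {q r l : ℝ} (hr : 0 < r) {T : X → ℝ≥0∞} {f : Y → ℝ≥0∞}
    (hf : Measurable f) (hl : 0 < l) (h : μ {x | ENNReal.ofReal l < T x} ≤
      ENNReal.ofReal l ^ (-r) * ∫⁻ y in {y | ENNReal.ofReal l ^ r < f y}, f y ∂ν) :
    μ {x | ENNReal.ofReal l < T x} * ENNReal.ofReal (l ^ (q - 1)) ≤
      ν.withDensity f {y | ENNReal.ofReal l < f y ^ r⁻¹} * ENNReal.ofReal (l ^ (q - r - 1)) := by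
  have hl0 : ENNReal.ofReal l ≠ 0 := by simpa using hl
  simp_rw [ENNReal.lt_rpow_inv_iff hr]
  rw [withDensity_apply _ (measurableSet_lt measurable_const hf),
    ← ENNReal.ofReal_rpow_of_pos hl, ← ENNReal.ofReal_rpow_of_pos hl]
  calc μ {x | ENNReal.ofReal l < T x} * ENNReal.ofReal l ^ (q - 1)
      ≤ ENNReal.ofReal l ^ (-r) * (∫⁻ y in {y | ENNReal.ofReal l ^ r < f y}, f y ∂ν) *
          ENNReal.ofReal l ^ (q - 1) := by
        gcongr
    _ = (∫⁻ y in {y | ENNReal.ofReal l ^ r < f y}, f y ∂ν) * ENNReal.ofReal l ^ (q - r - 1) := by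
        rw [mul_comm (ENNReal.ofReal l ^ _), mul_assoc,
          ← ENNReal.rpow_add _ _ hl0 ENNReal.ofReal_ne_top]
        ring_nf

/-- A weak-type bound for `T` in terms of the part of `f` above each height self-improves to a
strong one: the right-hand side of the layer cake formula for `T` is the one for `f ^ (p / q)` with
respect to the measure with density `f`. -/
lemma lintegral_rpow_le_of_measure_lt_le {p q : ℝ} (hp : 1 < p) (hq : 0 < q) {T : X → ℝ≥0∞}
    (hT : Measurable T) {f : Y → ℝ≥0∞} (hf : Measurable f)
    (h : ∀ l : ℝ≥0∞, l ≠ 0 → l ≠ ⊤ →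
      μ {x | l < T x} ≤ l ^ (-(q / p)) * ∫⁻ y in {y | l ^ (q / p) < f y}, f y ∂ν) :
    ∫⁻ x, T x ^ q ∂μ ≤ ENNReal.ofReal q / ENNReal.ofReal (q - q / p) * ∫⁻ y, f y ^ p ∂ν := by
  have hp0 : 0 < p := by linarith
  have he : 0 < q - q / p := sub_pos.2 (div_lt_self hq hp)
  have hfp : Measurable fun y => f y ^ (q / p)⁻¹ := hf.pow_const _
  calc ∫⁻ x, T x ^ q ∂μ
      = ENNReal.ofReal q * ∫⁻ l in Set.Ioi (0 : ℝ),
          μ {x | ENNReal.ofReal l < T x} * ENNReal.ofReal (l ^ (q - 1)) :=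
        lintegral_rpow_eq_lintegral_measure_lt hT.aemeasurable hq
    _ ≤ ENNReal.ofReal q * ∫⁻ l in Set.Ioi (0 : ℝ),
          ν.withDensity f {y | ENNReal.ofReal l < f y ^ (q / p)⁻¹} *
            ENNReal.ofReal (l ^ (q - q / p - 1)) := by
        refine mul_le_mul_right (setLIntegral_mono' measurableSet_Ioi fun l hl => ?_) _
        exact measure_lt_mul_rpow_le (div_pos hq hp0) hf hl (h _ (by simpa using hl) (by simp))
    _ = ENNReal.ofReal q / ENNReal.ofReal (q - q / p) *
          ∫⁻ y, (f y ^ (q / p)⁻¹) ^ (q - q / p) ∂ν.withDensity f := by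
        rw [lintegral_rpow_eq_lintegral_measure_lt hfp.aemeasurable he, ← mul_assoc,
          ENNReal.div_mul_cancel (by simpa using he) (by simp)]
    _ = ENNReal.ofReal q / ENNReal.ofReal (q - q / p) * ∫⁻ y, f y ^ p ∂ν := by
        rw [lintegral_withDensity_eq_lintegral_mul _ hf (hfp.pow_const _)]
        congr 2 with y
        have hexp : (q / p)⁻¹ * (q - q / p) = p - 1 := by field_simp
        rw [Pi.mul_apply, ← ENNReal.rpow_mul, hexp]
        nth_rw 1 [← ENNReal.rpow_one (f y)]
        rw [← ENNReal.rpow_add_of_nonneg _ _ zero_le_one (by linarith), add_sub_cancel]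

end LayerCake

section HardyLittlewoodSobolev

variable {E : Type*} [NormedAddCommGroup E]

/-- The restriction of the Riesz kernel `‖z‖ ^ (-s)` to the ball of radius `R`. -/
def nearKernel (s : ℝ) (R : ℝ≥0∞) : E → ℝ≥0∞ :=
  {z | ‖z‖ₑ < R}.indicator fun z => ‖z‖ₑ ^ (-s)

/-- The restriction of the Riesz kernel `‖z‖ ^ (-s)` to the complement of the ball of
radius `R`. -/
def farKernel (s : ℝ) (R : ℝ≥0∞) : E → ℝ≥0∞ :=
  {z | R ≤ ‖z‖ₑ}.indicator fun z => ‖z‖ₑ ^ (-s)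

lemma nearKernel_rpow {r : ℝ} (hr : 0 < r) (s : ℝ) (R : ℝ≥0∞) (z : E) :
    nearKernel s R z ^ r = nearKernel (s * r) R z := by
  simp only [nearKernel, Set.indicator_apply]
  split_ifs
  · rw [← ENNReal.rpow_mul, neg_mul]
  · exact ENNReal.zero_rpow_of_pos hr

lemma farKernel_rpow {r : ℝ} (hr : 0 < r) (s : ℝ) (R : ℝ≥0∞) (z : E) :
    farKernel s R z ^ r = farKernel (s * r) R z := by
  simp only [farKernel, Set.indicator_apply]
  split_ifs
  · rw [← ENNReal.rpow_mul, neg_mul]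
  · exact ENNReal.zero_rpow_of_pos hr

variable [MeasurableSpace E]

/-- The Riesz potential `‖·‖ ^ (-s) ∗ f` of a nonnegative function. -/
def rieszPotential (μ : Measure E) (s : ℝ) (f : E → ℝ≥0∞) (x : E) : ℝ≥0∞ :=
  ∫⁻ y, ‖x - y‖ₑ ^ (-s) * f y ∂μ

section Measurability

variable [BorelSpace E] {X : Type*} [MeasurableSpace X] (s : ℝ) {R : X → ℝ≥0∞} {g : X → E}

lemma measurable_nearKernel (hR : Measurable R) (hg : Measurable g) :
    Measurable fun x => nearKernel s (R x) (g x) :=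
  (hg.enorm.pow_const _).indicator (measurableSet_lt hg.enorm hR)

lemma measurable_farKernel (hR : Measurable R) (hg : Measurable g) :
    Measurable fun x => farKernel s (R x) (g x) :=
  (hg.enorm.pow_const _).indicator (measurableSet_le hR hg.enorm)

end Measurability

section Convolution

variable [MeasurableSub₂ E] {μ : Measure E} [SFinite μ] {k g : E → ℝ≥0∞}

lemma measurable_lintegral_sub_mul (hk : Measurable k) (hg : Measurable g) :
    Measurable fun x => ∫⁻ y, k (x - y) * g y ∂μ :=
  ((hk.comp measurable_sub).mul (hg.comp measurable_snd)).lintegral_prod_right'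

lemma lintegral_lintegral_sub_mul [MeasurableAdd E] [μ.IsAddRightInvariant] (hk : Measurable k)
    (hg : Measurable g) :
    ∫⁻ x, ∫⁻ y, k (x - y) * g y ∂μ ∂μ = (∫⁻ z, k z ∂μ) * ∫⁻ y, g y ∂μ := by
  rw [lintegral_lintegral_swap
    ((hk.comp measurable_sub).mul (hg.comp measurable_snd)).aemeasurable,
    ← lintegral_const_mul _ hg]
  refine lintegral_congr fun y => ?_
  rw [lintegral_mul_const _ (by fun_prop), lintegral_sub_right_eq_self k y]

end Convolution

lemma measurable_rieszPotential [BorelSpace E] [SecondCountableTopology E] (μ : Measure E)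
    [SFinite μ] (s : ℝ) {f : E → ℝ≥0∞} (hf : Measurable f) : Measurable (rieszPotential μ s f) :=
  measurable_lintegral_sub_mul (measurable_enorm.pow_const (-s)) hf

lemma rieszPotential_le_far_add_near [BorelSpace E] {μ : Measure E} [μ.IsAddLeftInvariant]
    [μ.IsNegInvariant] (s : ℝ) (R h : ℝ≥0∞) {f : E → ℝ≥0∞}
    (hf : Measurable f) (x : E) :
    rieszPotential μ s f x ≤ ∫⁻ y, farKernel s R (x - y) * f y ∂μ +
      ((∫⁻ z, nearKernel s R z ∂μ) * h +
        ∫⁻ y, nearKernel s R (x - y) * {y | h < f y}.indicator f y ∂μ) := by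
  have hnear : Measurable fun y => nearKernel s R (x - y) :=
    measurable_nearKernel s measurable_const (measurable_id.const_sub x)
  have hfar : Measurable fun y => farKernel s R (x - y) * f y :=
    (measurable_farKernel s measurable_const (measurable_id.const_sub x)).mul hf
  rw [← lintegral_sub_left_eq_self (nearKernel s R) x, ← lintegral_mul_const _ hnear,
    ← lintegral_add_left (by fun_prop), ← lintegral_add_left hfar]
  refine lintegral_mono fun y => ?_
  by_cases hy : ‖x - y‖ₑ < R
  · have hk : nearKernel s R (x - y) = ‖x - y‖ₑ ^ (-s) := Set.indicator_of_mem (by exact hy) _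
    rw [← hk, ← mul_add]
    refine le_add_left ?_
    gcongr
    by_cases hh : h < f y
    · rw [Set.indicator_of_mem (by exact hh)]
      exact le_add_self
    · exact le_add_right (not_lt.1 hh)
  · have hk : farKernel s R (x - y) = ‖x - y‖ₑ ^ (-s) := Set.indicator_of_mem (by simpa using hy) _
    rw [hk]
    exact le_self_add

variable [NormedSpace ℝ E] [FiniteDimensional ℝ E] [BorelSpace E] (μ : Measure E)
  [μ.IsAddHaarMeasure]

lemma exists_eLpNorm'_farKernel_eq {r s : ℝ} (hr : 0 < r) (hs : Module.finrank ℝ E / r < s) :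
    ∃ A : ℝ≥0∞, A ≠ ⊤ ∧ ∀ R : ℝ≥0∞, R ≠ 0 → R ≠ ⊤ →
      eLpNorm' (farKernel s R) r μ = A * R ^ (Module.finrank ℝ E / r - s) := by
  obtain ⟨A, hA, hfar⟩ := exists_setLIntegral_le_enorm_eq μ (a := -(s * r))
    (neg_lt_neg ((div_lt_iff₀ hr).1 hs))
  refine ⟨A ^ (1 / r), by finiteness, fun R hR hR' => ?_⟩
  have hexp : (Module.finrank ℝ E + -(s * r)) * (1 / r) = Module.finrank ℝ E / r - s := by
    field_simp
    ring
  simp_rw [eLpNorm'_eq_lintegral_enorm, enorm_eq_self, farKernel_rpow hr]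
  unfold farKernel
  rw [lintegral_indicator (measurableSet_le measurable_const measurable_enorm), hfar R hR hR',
    ENNReal.mul_rpow_of_nonneg _ _ (by positivity), ← ENNReal.rpow_mul, hexp]

lemma exists_eLpNorm'_nearKernel_eq [Nontrivial E] {r s : ℝ} (hr : 0 < r)
    (hs : s < Module.finrank ℝ E / r) :
    ∃ A : ℝ≥0∞, A ≠ ⊤ ∧ ∀ R : ℝ≥0∞, R ≠ 0 → R ≠ ⊤ →
      eLpNorm' (nearKernel s R) r μ = A * R ^ (Module.finrank ℝ E / r - s) := by
  obtain ⟨A, hA, hnear⟩ := exists_setLIntegral_enorm_lt_eq μ (a := -(s * r))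
    (neg_lt_neg ((lt_div_iff₀ hr).1 hs))
  refine ⟨A ^ (1 / r), by finiteness, fun R hR hR' => ?_⟩
  have hexp : (Module.finrank ℝ E + -(s * r)) * (1 / r) = Module.finrank ℝ E / r - s := by
    field_simp
    ring
  simp_rw [eLpNorm'_eq_lintegral_enorm, enorm_eq_self, nearKernel_rpow hr]
  unfold nearKernel
  rw [lintegral_indicator (measurableSet_lt measurable_enorm measurable_const), hnear R hR hR',
    ENNReal.mul_rpow_of_nonneg _ _ (by positivity), ← ENNReal.rpow_mul, hexp]

lemma exists_lintegral_nearKernel_eq [Nontrivial E] {s : ℝ} (hs : s < Module.finrank ℝ E) :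
    ∃ A : ℝ≥0∞, A ≠ ⊤ ∧ ∀ R : ℝ≥0∞, R ≠ 0 → R ≠ ⊤ →
      ∫⁻ z, nearKernel s R z ∂μ = A * R ^ (Module.finrank ℝ E - s) := by
  obtain ⟨A, hA, hnear⟩ := exists_eLpNorm'_nearKernel_eq μ (s := s) one_pos (by simpa using hs)
  simp_rw [eLpNorm'_eq_lintegral_enorm, enorm_eq_self, div_one, ENNReal.rpow_one] at hnear
  exact ⟨A, hA, hnear⟩

lemma lintegral_farKernel_mul_le {p p' : ℝ} (hp : p.HolderConjugate p') (s : ℝ) (R : ℝ≥0∞)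
    {f : E → ℝ≥0∞} (hf : Measurable f) (x : E) :
    ∫⁻ y, farKernel s R (x - y) * f y ∂μ ≤ eLpNorm' (farKernel s R) p' μ * eLpNorm' f p μ := by
  have hnorm : eLpNorm' (fun y => farKernel s R (x - y)) p' μ = eLpNorm' (farKernel s R) p' μ := by
    simp_rw [eLpNorm'_eq_lintegral_enorm, enorm_eq_self]
    rw [lintegral_sub_left_eq_self (fun y => farKernel s R y ^ p') x]
  rw [← hnorm]
  exact ENNReal.lintegral_mul_le_Lp_mul_Lq μ hp.symm
    (measurable_farKernel s measurable_const (measurable_id.const_sub x)).aemeasurable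
    hf.aemeasurable

variable [Nontrivial E]

/-- The radius `l ^ (-(q / d))` and the height `l ^ (q / p)` are the ones for which both the far
part and the part of `f` below the height contribute at most a multiple of `l`. -/
lemma exists_rieszPotential_le {p q s : ℝ} (hp : 1 < p) (hpq : p < q)
    (hs : s = Module.finrank ℝ E * (1 - 1 / p + 1 / q)) :
    ∃ b : ℝ≥0∞, b ≠ ⊤ ∧ ∀ l : ℝ≥0∞, l ≠ 0 → l ≠ ⊤ →
      ∫⁻ z, nearKernel s (l ^ (-(q / Module.finrank ℝ E))) z ∂μ ≤ b * l ^ (1 - q / p) ∧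
      ∀ f : E → ℝ≥0∞, Measurable f → eLpNorm' f p μ ≤ 1 → ∀ x,
        rieszPotential μ s f x ≤ b * l + ∫⁻ y, nearKernel s (l ^ (-(q / Module.finrank ℝ E)))
          (x - y) * {y | l ^ (q / p) < f y}.indicator f y ∂μ := by
  have hc : p.HolderConjugate (p / (p - 1)) := .conjExponent hp
  set p' := p / (p - 1)
  have hp' : 0 < p' := hc.symm.pos
  have hinv : 1 / p' = 1 - 1 / p := by
    have := hc.inv_add_inv_eq_one
    simp only [one_div]
    linarith
  have hq : 0 < q := by linarith
  have hlt : 1 / q < 1 / p := one_div_lt_one_div_of_lt (by linarith) hpq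
  have hd : (0 : ℝ) < Module.finrank ℝ E := mod_cast Module.finrank_pos
  set d : ℝ := (Module.finrank ℝ E : ℝ)
  have hdp : d / p' - s = -(d / q) := by
    rw [hs, div_eq_mul_one_div, hinv]
    ring
  have hdq : 0 < d / q := by positivity
  obtain ⟨A₁, hA₁, hfar⟩ := exists_eLpNorm'_farKernel_eq μ hp' (s := s) (by linarith)
  obtain ⟨A₂, hA₂, hnear⟩ := exists_lintegral_nearKernel_eq μ (s := s) (by rw [hs]; nlinarith)
  refine ⟨A₁ + A₂, by finiteness, fun l hl hl' => ?_⟩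
  have hR : l ^ (-(q / d)) ≠ 0 := (ENNReal.rpow_pos (pos_iff_ne_zero.2 hl) hl').ne'
  have hR' : l ^ (-(q / d)) ≠ ⊤ := ENNReal.rpow_ne_top_of_ne_zero hl hl'
  have hRfar : (l ^ (-(q / d))) ^ (d / p' - s) = l := by
    have : -(q / d) * -(d / q) = 1 := by field_simp
    rw [hdp, ← ENNReal.rpow_mul, this, ENNReal.rpow_one]
  have hRnear : (l ^ (-(q / d))) ^ (d - s) = l ^ (1 - q / p) := by
    have : -(q / d) * (d - s) = 1 - q / p := by
      rw [hs]
      field_simp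
      ring
    rw [← ENNReal.rpow_mul, this]
  refine ⟨?_, fun f hf hf1 x => ?_⟩
  · rw [hnear _ hR hR', hRnear]
    gcongr
    exact le_add_self
  · refine (rieszPotential_le_far_add_near s (l ^ (-(q / d))) (l ^ (q / p)) hf x).trans ?_
    rw [← add_assoc, hnear _ hR hR', hRnear, mul_assoc A₂, ← ENNReal.rpow_add _ _ hl hl',
      sub_add_cancel, ENNReal.rpow_one, add_mul]
    gcongr
    refine (lintegral_farKernel_mul_le μ hc s _ hf x).trans ?_
    rw [hfar _ hR hR', hRfar]
    exact mul_le_of_le_one_right' hf1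

lemma exists_measure_lt_rieszPotential_le {p q s : ℝ} (hp : 1 < p) (hpq : p < q)
    (hs : s = Module.finrank ℝ E * (1 - 1 / p + 1 / q)) :
    ∃ B : ℝ≥0∞, B ≠ 0 ∧ B ≠ ⊤ ∧ ∀ f : E → ℝ≥0∞, Measurable f → eLpNorm' f p μ ≤ 1 →
      ∀ l : ℝ≥0∞, l ≠ 0 → l ≠ ⊤ → μ {x | l < rieszPotential μ s f x / B} ≤
        l ^ (-(q / p)) * ∫⁻ y in {y | l ^ (q / p) < f y}, f y ∂μ := by
  obtain ⟨b, hb, h⟩ := exists_rieszPotential_le μ hp hpq hs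
  have hB0 : 2 * (b + 1) ≠ 0 := by simp
  have hB : 2 * (b + 1) ≠ ⊤ := by finiteness
  refine ⟨2 * (b + 1), hB0, hB, fun f hf hf1 l hl hl' => ?_⟩
  obtain ⟨hnear, hpot⟩ := h l hl hl'
  specialize hpot f hf hf1
  set k : E → ℝ≥0∞ := nearKernel s (l ^ (-(q / Module.finrank ℝ E)))
  have hk : Measurable k := measurable_nearKernel s measurable_const measurable_id
  have hset : MeasurableSet {y | l ^ (q / p) < f y} := measurableSet_lt measurable_const hf
  have hbl0 : (b + 1) * l ≠ 0 := mul_ne_zero (by simp) hl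
  have hbl : (b + 1) * l ≠ ⊤ := by finiteness
  have hsub : {x | l < rieszPotential μ s f x / (2 * (b + 1))} ⊆
      {x | (b + 1) * l ≤ ∫⁻ y, k (x - y) * {y | l ^ (q / p) < f y}.indicator f y ∂μ} := by
    intro x hx
    refine ((ENNReal.add_lt_add_iff_left hbl).1 ?_).le
    calc (b + 1) * l + (b + 1) * l = l * (2 * (b + 1)) := by ring
      _ < rieszPotential μ s f x := (ENNReal.lt_div_iff_mul_lt (Or.inl hB0) (Or.inl hB)).1 hx
      _ ≤ _ := hpot x
      _ ≤ _ := by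
        gcongr
        exact le_self_add
  refine (measure_mono hsub).trans ((meas_ge_le_lintegral_div
    (measurable_lintegral_sub_mul hk (hf.indicator hset)).aemeasurable hbl0 hbl).trans
      (ENNReal.div_le_of_le_mul ?_))
  rw [lintegral_lintegral_sub_mul hk (hf.indicator hset), lintegral_indicator hset]
  calc _ ≤ (b + 1) * l ^ (1 - q / p) * ∫⁻ y in {y | l ^ (q / p) < f y}, f y ∂μ := by
        gcongr
        exact hnear.trans (by gcongr; exact le_self_add)
    _ = _ := by
        rw [sub_eq_neg_add, ENNReal.rpow_add _ _ hl hl', ENNReal.rpow_one]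
        ring

lemma exists_eLpNorm'_rieszPotential_le_of_le_one {p q s : ℝ} (hp : 1 < p) (hpq : p < q)
    (hs : s = Module.finrank ℝ E * (1 - 1 / p + 1 / q)) :
    ∃ C : ℝ≥0∞, C ≠ ⊤ ∧ ∀ f : E → ℝ≥0∞, Measurable f → eLpNorm' f p μ ≤ 1 →
      eLpNorm' (rieszPotential μ s f) q μ ≤ C := by
  have hp0 : 0 < p := by linarith
  have hq0 : 0 < q := by linarith
  have he : 0 < q - q / p := sub_pos.2 (div_lt_self hq0 hp)
  obtain ⟨B, hB0, hB, hlevel⟩ := exists_measure_lt_rieszPotential_le μ hp hpq hs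
  refine ⟨B * (ENNReal.ofReal q / ENNReal.ofReal (q - q / p)) ^ (1 / q), ?_, fun f hf hf1 => ?_⟩
  · have : ENNReal.ofReal q / ENNReal.ofReal (q - q / p) ≠ ⊤ :=
      ENNReal.div_ne_top (by simp) (by simpa using he)
    finiteness
  have hT : Measurable fun x => rieszPotential μ s f x / B :=
    (measurable_rieszPotential μ s hf).div_const _
  have hscale : rieszPotential μ s f = fun x => B * (rieszPotential μ s f x / B) :=
    funext fun x => (ENNReal.mul_div_cancel hB0 hB).symm
  rw [hscale, eLpNorm'_const_mul hq0 B hT]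
  change _ * (∫⁻ x, (rieszPotential μ s f x / B) ^ q ∂μ) ^ (1 / q) ≤ _
  gcongr
  refine (lintegral_rpow_le_of_measure_lt_le hp hq0 hT hf (hlevel f hf hf1)).trans
    (mul_le_of_le_one_right' ?_)
  rw [← eLpNorm'_rpow_eq_lintegral hp0]
  exact ENNReal.rpow_le_one hf1 hp0.le

theorem exists_hardy_littlewood_sobolev {p q s : ℝ} (hp : 1 < p) (hpq : p < q)
    (hs : s = Module.finrank ℝ E * (1 - 1 / p + 1 / q)) :
    ∃ C : ℝ≥0∞, C ≠ ⊤ ∧ KernelBound μ μ p q (fun x y => ‖x - y‖ₑ ^ (-s)) C := by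
  have hp0 : 0 < p := by linarith
  have hq0 : 0 < q := by linarith
  obtain ⟨C, hC, h⟩ := exists_eLpNorm'_rieszPotential_le_of_le_one μ hp hpq hs
  refine ⟨C + 1, by finiteness, fun f hf => ?_⟩
  change eLpNorm' (rieszPotential μ s f) q μ ≤ _
  rcases eq_or_ne (eLpNorm' f p μ) ⊤ with htop | htop
  · simp [htop]
  rcases eq_or_ne (eLpNorm' f p μ) 0 with hzero | hzero
  · have hf0 : f =ᵐ[μ] 0 := (eLpNorm'_eq_zero_iff hp0 hf.aestronglyMeasurable).1 hzero
    have hpot : rieszPotential μ s f = 0 := funext fun x =>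
      (lintegral_congr_ae (hf0.mono fun y hy => by simp [hy])).trans lintegral_zero
    simp [hpot, hq0]
  set N := eLpNorm' f p μ
  have hg : Measurable fun y => N⁻¹ * f y := hf.const_mul _
  have hgN : eLpNorm' (fun y => N⁻¹ * f y) p μ ≤ 1 := by
    rw [eLpNorm'_const_mul hp0 _ hf, ENNReal.inv_mul_cancel hzero htop]
  have hpot : rieszPotential μ s f = fun x => N * rieszPotential μ s (fun y => N⁻¹ * f y) x := by
    funext x
    simp_rw [rieszPotential]
    rw [← lintegral_const_mul' _ _ htop]
    refine lintegral_congr fun y => ?_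
    rw [mul_left_comm, ← mul_assoc N, ENNReal.mul_inv_cancel hzero htop, one_mul]
  rw [hpot, eLpNorm'_const_mul hq0 _ (measurable_rieszPotential μ s hg), mul_comm]
  gcongr
  exact (h _ hg hgN).trans le_self_add

end HardyLittlewoodSobolev

lemma ennreal_rpow_neg_le_mul {x y c : ℝ≥0∞} {t : ℝ} (ht : 0 ≤ t) (hc : c ≠ ⊤) (hc0 : c ≠ 0)
    (hy : y ≠ ⊤) (h : x ≤ c * y) : y ^ (-t) ≤ c ^ t * x ^ (-t) :=
  calc y ^ (-t) = c ^ t * (c * y) ^ (-t) := by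
        rw [ENNReal.mul_rpow_of_ne_top hc hy, ← mul_assoc, ← ENNReal.rpow_add _ _ hc0 hc,
          add_neg_cancel, ENNReal.rpow_zero, one_mul]
    _ ≤ c ^ t * x ^ (-t) :=
        mul_le_mul_right (ennreal_rpow_le_rpow_of_nonpos (neg_nonpos.2 ht) h) _

lemma ennreal_rpow_le_mul_of_comparable {x y c : ℝ≥0∞} (hy : y ≠ ⊤) (hc : c ≠ ⊤) (hc0 : c ≠ 0)
    (h₁ : x ≤ c * y) (h₂ : y ≤ c * x) (u : ℝ) : y ^ u ≤ c ^ |u| * x ^ u := by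
  rcases le_total 0 u with hu | hu
  · rw [abs_of_nonneg hu, ← ENNReal.mul_rpow_of_nonneg _ _ hu]
    exact ENNReal.rpow_le_rpow h₂ hu
  · simpa [abs_of_nonpos hu] using ennreal_rpow_neg_le_mul (neg_nonneg.2 hu) hc hc0 hy h₁

section Hardy

variable {E : Type*} [NormedAddCommGroup E]

lemma enorm_rpow_mul_nearKernel {z : E} (hz : z ≠ 0) (u s : ℝ) (R : ℝ≥0∞) :
    ‖z‖ₑ ^ u * nearKernel s R z = nearKernel (s - u) R z := by
  have hz0 : ‖z‖ₑ ≠ 0 := by simpa using hz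
  simp only [nearKernel, Set.indicator_apply]
  split_ifs
  · rw [← ENNReal.rpow_add _ _ hz0 enorm_ne_top, neg_sub, sub_eq_add_neg]
  · exact mul_zero _

lemma enorm_rpow_mul_farKernel {z : E} (hz : z ≠ 0) (u s : ℝ) (R : ℝ≥0∞) :
    ‖z‖ₑ ^ u * farKernel s R z = farKernel (s - u) R z := by
  have hz0 : ‖z‖ₑ ≠ 0 := by simpa using hz
  simp only [farKernel, Set.indicator_apply]
  split_ifs
  · rw [← ENNReal.rpow_add _ _ hz0 enorm_ne_top, neg_sub, sub_eq_add_neg]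
  · exact mul_zero _

variable [NormedSpace ℝ E] [FiniteDimensional ℝ E] [MeasurableSpace E] [BorelSpace E]
  {μ : Measure E} [μ.IsAddHaarMeasure] [Nontrivial E] {p p' q : ℝ}

lemma KernelBound.of_homogeneous (hp : p.HolderConjugate p') (hpq : p ≤ q)
    {φ ψ : ℝ≥0∞ → E → ℝ≥0∞} (hφ : Measurable fun z : E × E => φ ‖z.1‖ₑ z.2)
    (hψ : Measurable fun z : E × E => ψ ‖z.2‖ₑ z.1) {u c : ℝ} {C₁ C₂ : ℝ≥0∞}
    (h₁ : ∀ R : ℝ≥0∞, R ≠ 0 → R ≠ ⊤ → eLpNorm' (φ R) p' μ = C₁ * R ^ u)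
    (h₂ : ∀ R : ℝ≥0∞, R ≠ 0 → R ≠ ⊤ →
      eLpNorm' (fun x => ‖x‖ₑ ^ u * ψ R x) q μ = C₂ * R ^ (-c)) :
    KernelBound μ μ p q (fun x y => φ ‖x‖ₑ y * (‖y‖ₑ ^ c * ψ ‖y‖ₑ x)) (C₁ * C₂) := by
  have hq : 0 < q := hp.pos.trans_le hpq
  refine .of_mul hp hpq hφ ((measurable_snd.enorm.pow_const c).mul hψ)
    (A := fun x => C₁ * ‖x‖ₑ ^ u) (by fun_prop) ?_ ?_
  · filter_upwards [Measure.ae_ne μ (0 : E)] with x hx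
    exact (h₁ _ (by simpa using hx) enorm_ne_top).le
  · filter_upwards [Measure.ae_ne μ (0 : E)] with y hy
    have hy0 : ‖y‖ₑ ≠ 0 := by simpa using hy
    have hψy : Measurable fun x => ‖x‖ₑ ^ u * ψ ‖y‖ₑ x :=
      (measurable_enorm.pow_const u).mul (hψ.comp measurable_prodMk_right)
    have hfactor : ∀ x, C₁ * ‖x‖ₑ ^ u * (‖y‖ₑ ^ c * ψ ‖y‖ₑ x) =
        C₁ * ‖y‖ₑ ^ c * (‖x‖ₑ ^ u * ψ ‖y‖ₑ x) := fun x => by ring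
    simp_rw [hfactor]
    rw [eLpNorm'_const_mul hq _ hψy, h₂ _ hy0 enorm_ne_top, mul_mul_mul_comm,
      ← ENNReal.rpow_add _ _ hy0 enorm_ne_top, add_neg_cancel, ENNReal.rpow_zero, mul_one]

variable (μ)

lemma exists_kernelBound_inner {a b : ℝ} (hp : p.HolderConjugate p') (hpq : p ≤ q)
    (hab : a + b = Module.finrank ℝ E / p' + Module.finrank ℝ E / q)
    (ha : a < Module.finrank ℝ E / p') :
    ∃ C : ℝ≥0∞, C ≠ ⊤ ∧ KernelBound μ μ p q (fun x y => ‖x‖ₑ ^ (-b) * nearKernel a ‖x‖ₑ y) C := by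
  have hq : 0 < q := hp.pos.trans_le hpq
  set d : ℝ := (Module.finrank ℝ E : ℝ)
  obtain ⟨σ, haσ, hσ⟩ := exists_between ha
  obtain ⟨C₁, hC₁, hnear⟩ := exists_eLpNorm'_nearKernel_eq μ hp.symm.pos hσ
  obtain ⟨C₂, hC₂, hfar⟩ := exists_eLpNorm'_farKernel_eq μ (s := b - (d / p' - σ)) hq (by linarith)
  have key : KernelBound μ μ p q
      (fun x y => nearKernel σ ‖x‖ₑ y * (‖y‖ₑ ^ (σ - a) * farKernel b ‖y‖ₑ x)) (C₁ * C₂) := by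
    refine .of_homogeneous hp hpq (measurable_nearKernel σ measurable_fst.enorm measurable_snd)
      (measurable_farKernel b measurable_snd.enorm measurable_fst) hnear fun R hR hR' => ?_
    have hae : (fun x => ‖x‖ₑ ^ (d / p' - σ) * farKernel b R x) =ᵐ[μ]
        farKernel (b - (d / p' - σ)) R :=
      (Measure.ae_ne μ 0).mono fun x hx => enorm_rpow_mul_farKernel hx _ _ _
    have hexp : d / q - (b - (d / p' - σ)) = -(σ - a) := by linarith
    rw [eLpNorm'_congr_ae hae, hfar R hR hR', hexp]
  refine ⟨1 * (C₁ * C₂), by finiteness, key.of_ae_le_const_mul hq ENNReal.one_ne_top ?_⟩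
  filter_upwards with x
  filter_upwards [Measure.ae_ne μ (0 : E)] with y hy
  rw [one_mul, ← mul_assoc, mul_comm (nearKernel σ _ y), enorm_rpow_mul_nearKernel hy,
    sub_sub_cancel]
  by_cases hxy : ‖y‖ₑ < ‖x‖ₑ
  · have hfar : farKernel b ‖y‖ₑ x = ‖x‖ₑ ^ (-b) := Set.indicator_of_mem (by exact hxy.le) _
    rw [hfar, mul_comm]
  · have hnear : nearKernel a ‖x‖ₑ y = 0 := Set.indicator_of_notMem (by exact hxy) _
    simp [hnear]

lemma exists_kernelBound_outer {a b : ℝ} (hp : p.HolderConjugate p') (hpq : p ≤ q)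
    (hab : a + b = Module.finrank ℝ E / p' + Module.finrank ℝ E / q)
    (hb : b < Module.finrank ℝ E / q) :
    ∃ C : ℝ≥0∞, C ≠ ⊤ ∧ KernelBound μ μ p q (fun x y => nearKernel b ‖y‖ₑ x * ‖y‖ₑ ^ (-a)) C := by
  have hq : 0 < q := hp.pos.trans_le hpq
  set d : ℝ := (Module.finrank ℝ E : ℝ)
  obtain ⟨τ, hbτ, hτ⟩ := exists_between hb
  set σ := d / p' + τ - b
  obtain ⟨C₁, hC₁, hfar⟩ := exists_eLpNorm'_farKernel_eq μ (s := σ) hp.symm.pos (by linarith)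
  obtain ⟨C₂, hC₂, hnear⟩ := exists_eLpNorm'_nearKernel_eq μ (s := b - (d / p' - σ)) hq
    (by linarith)
  have key : KernelBound μ μ p q
      (fun x y => farKernel σ ‖x‖ₑ y * (‖y‖ₑ ^ (σ - a) * nearKernel b ‖y‖ₑ x)) (C₁ * C₂) := by
    refine .of_homogeneous hp hpq (measurable_farKernel σ measurable_fst.enorm measurable_snd)
      (measurable_nearKernel b measurable_snd.enorm measurable_fst) hfar fun R hR hR' => ?_
    have hae : (fun x => ‖x‖ₑ ^ (d / p' - σ) * nearKernel b R x) =ᵐ[μ]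
        nearKernel (b - (d / p' - σ)) R :=
      (Measure.ae_ne μ 0).mono fun x hx => enorm_rpow_mul_nearKernel hx _ _ _
    have hexp : d / q - (b - (d / p' - σ)) = -(σ - a) := by linarith
    rw [eLpNorm'_congr_ae hae, hnear R hR hR', hexp]
  refine ⟨1 * (C₁ * C₂), by finiteness, key.of_ae_le_const_mul hq ENNReal.one_ne_top ?_⟩
  filter_upwards with x
  filter_upwards [Measure.ae_ne μ (0 : E)] with y hy
  rw [one_mul, ← mul_assoc, mul_comm (farKernel σ _ y), enorm_rpow_mul_farKernel hy,
    sub_sub_cancel, mul_comm]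
  by_cases hxy : ‖x‖ₑ < ‖y‖ₑ
  · have hfar : farKernel a ‖x‖ₑ y = ‖y‖ₑ ^ (-a) := Set.indicator_of_mem (by exact hxy.le) _
    rw [hfar]
  · have hnear : nearKernel b ‖y‖ₑ x = 0 := Set.indicator_of_notMem (by exact hxy) _
    simp [hnear]

end Hardy

section SteinWeiss

/-- The pairs of vectors whose norms are within a factor of two of each other: the part of the
product on which the two weights of the Stein–Weiss kernel can be traded for one another. -/
def comparableRegion (E : Type*) [NormedAddCommGroup E] : Set (E × E) :=
  {z | ‖z.1‖ₑ ≤ 2 * ‖z.2‖ₑ ∧ ‖z.2‖ₑ ≤ 2 * ‖z.1‖ₑ}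

variable {E : Type*} [NormedAddCommGroup E]

/-- The Riesz kernel `‖x - y‖ ^ (-t)` with the weights `‖x‖ ^ (-β)` and `‖y‖ ^ (-α)`. -/
def steinWeissKernel (α β t : ℝ) (x y : E) : ℝ≥0∞ :=
  ‖x‖ₑ ^ (-β) * ‖x - y‖ₑ ^ (-t) * ‖y‖ₑ ^ (-α)

lemma enorm_sub_le_three_mul {x y : E} (h : ‖y‖ₑ ≤ 2 * ‖x‖ₑ) : ‖x - y‖ₑ ≤ 3 * ‖x‖ₑ :=
  calc ‖x - y‖ₑ ≤ ‖x‖ₑ + 2 * ‖x‖ₑ := enorm_sub_le.trans (by gcongr)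
    _ = 3 * ‖x‖ₑ := by ring

lemma enorm_sub_lt_four_mul {x y : E} (hx : x ≠ 0) (h : ‖y‖ₑ ≤ 2 * ‖x‖ₑ) :
    ‖x - y‖ₑ < 4 * ‖x‖ₑ :=
  (enorm_sub_le_three_mul h).trans_lt <|
    ENNReal.mul_lt_mul_left (by simpa using hx) enorm_ne_top (by norm_num)

lemma enorm_sub_rpow_le {x y : E} {t : ℝ} (ht : 0 ≤ t) (h : 2 * ‖y‖ₑ < ‖x‖ₑ) :
    ‖x - y‖ₑ ^ (-t) ≤ 2 ^ t * ‖x‖ₑ ^ (-t) := by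
  refine ennreal_rpow_neg_le_mul ht (by simp) (by simp) enorm_ne_top ?_
  have htriangle : ‖x‖ₑ ≤ ‖x - y‖ₑ + ‖y‖ₑ := by simpa using enorm_add_le (x - y) y
  refine (ENNReal.add_le_add_iff_right (enorm_ne_top (x := x))).1 ?_
  calc ‖x‖ₑ + ‖x‖ₑ ≤ (‖x - y‖ₑ + ‖y‖ₑ) + (‖x - y‖ₑ + ‖y‖ₑ) := by gcongr
    _ = 2 * ‖x - y‖ₑ + 2 * ‖y‖ₑ := by ring
    _ ≤ 2 * ‖x - y‖ₑ + ‖x‖ₑ := by gcongr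

lemma steinWeissKernel_le_enorm_sub_rpow {α β t : ℝ} (hαβ : 0 ≤ α + β) {x y : E} (hx : x ≠ 0)
    (hxy : x ≠ y) (hz : (x, y) ∈ comparableRegion E) :
    steinWeissKernel α β t x y ≤ 2 ^ |-α| * 3 ^ (α + β) * ‖x - y‖ₑ ^ (-(t + α + β)) := by
  have hx0 : ‖x‖ₑ ≠ 0 := by simpa using hx
  have hxy0 : ‖x - y‖ₑ ≠ 0 := by simpa [sub_eq_zero] using hxy
  have hy_le : ‖y‖ₑ ^ (-α) ≤ 2 ^ |-α| * ‖x‖ₑ ^ (-α) :=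
    ennreal_rpow_le_mul_of_comparable enorm_ne_top (by simp) (by simp) hz.1 hz.2 _
  have hx_le : ‖x‖ₑ ^ (-(α + β)) ≤ 3 ^ (α + β) * ‖x - y‖ₑ ^ (-(α + β)) :=
    ennreal_rpow_neg_le_mul hαβ (by simp) (by simp) enorm_ne_top (enorm_sub_le_three_mul hz.2)
  calc ‖x‖ₑ ^ (-β) * ‖x - y‖ₑ ^ (-t) * ‖y‖ₑ ^ (-α)
      ≤ ‖x‖ₑ ^ (-β) * ‖x - y‖ₑ ^ (-t) * (2 ^ |-α| * ‖x‖ₑ ^ (-α)) := by gcongr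
    _ = 2 ^ |-α| * ‖x - y‖ₑ ^ (-t) * ‖x‖ₑ ^ (-(α + β)) := by
        rw [neg_add α, ENNReal.rpow_add _ _ hx0 enorm_ne_top]
        ring
    _ ≤ 2 ^ |-α| * ‖x - y‖ₑ ^ (-t) * (3 ^ (α + β) * ‖x - y‖ₑ ^ (-(α + β))) := by gcongr
    _ = 2 ^ |-α| * 3 ^ (α + β) * ‖x - y‖ₑ ^ (-(t + α + β)) := by
        rw [add_assoc t, neg_add t, ENNReal.rpow_add _ _ hxy0 enorm_ne_top]
        ring

lemma steinWeissKernel_le_nearKernel_rpow_mul {p p' α β t : ℝ} (hp : p.HolderConjugate p')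
    {x y : E} (hx : x ≠ 0) (hy : y ≠ 0) (hxy : x ≠ y) (hz : (x, y) ∈ comparableRegion E) :
    steinWeissKernel α β t x y ≤ 2 ^ |-α + (α + β) / p| *
      ((nearKernel t (4 * ‖x‖ₑ) (x - y) * ‖x‖ₑ ^ (-(α + β))) ^ (1 / p') *
        (nearKernel t (4 * ‖y‖ₑ) (x - y) * ‖y‖ₑ ^ (-(α + β))) ^ (1 / p)) := by
  have hx0 : ‖x‖ₑ ≠ 0 := by simpa using hx
  have hy0 : ‖y‖ₑ ≠ 0 := by simpa using hy
  have hxy0 : ‖x - y‖ₑ ≠ 0 := by simpa [sub_eq_zero] using hxy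
  have hinv : 1 / p' + 1 / p = 1 := by simpa [add_comm] using hp.inv_add_inv_eq_one
  have hnear₁ : nearKernel t (4 * ‖x‖ₑ) (x - y) = ‖x - y‖ₑ ^ (-t) :=
    Set.indicator_of_mem (by exact enorm_sub_lt_four_mul hx hz.2) _
  have hnear₂ : nearKernel t (4 * ‖y‖ₑ) (x - y) = ‖x - y‖ₑ ^ (-t) :=
    Set.indicator_of_mem (by
      change ‖x - y‖ₑ < _
      rw [enorm_sub_rev]
      exact enorm_sub_lt_four_mul hy hz.1) _
  have hy_le : ‖y‖ₑ ^ (-α + (α + β) / p) ≤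
      2 ^ |-α + (α + β) / p| * ‖x‖ₑ ^ (-α + (α + β) / p) :=
    ennreal_rpow_le_mul_of_comparable enorm_ne_top (by simp) (by simp) hz.1 hz.2 _
  have hexp_y : -α = -α + (α + β) / p + -(α + β) * (1 / p) := by ring
  have hexp_x : -(α + β) * (1 / p') = -β + (-α + (α + β) / p) := by
    linear_combination (-(α + β)) * hinv
  have hexp_t : -t = -t * (1 / p') + -t * (1 / p) := by linear_combination t * hinv
  calc ‖x‖ₑ ^ (-β) * ‖x - y‖ₑ ^ (-t) * ‖y‖ₑ ^ (-α)
      = ‖x‖ₑ ^ (-β) * ‖x - y‖ₑ ^ (-t) *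
          (‖y‖ₑ ^ (-α + (α + β) / p) * ‖y‖ₑ ^ (-(α + β) * (1 / p))) := by
        rw [← ENNReal.rpow_add _ _ hy0 enorm_ne_top, ← hexp_y]
    _ ≤ ‖x‖ₑ ^ (-β) * ‖x - y‖ₑ ^ (-t) * (2 ^ |-α + (α + β) / p| *
          ‖x‖ₑ ^ (-α + (α + β) / p) * ‖y‖ₑ ^ (-(α + β) * (1 / p))) := by gcongr
    _ = 2 ^ |-α + (α + β) / p| * (‖x - y‖ₑ ^ (-t) * ‖x‖ₑ ^ (-(α + β) * (1 / p')) *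
          ‖y‖ₑ ^ (-(α + β) * (1 / p))) := by
        rw [hexp_x, ENNReal.rpow_add (-β) _ hx0 enorm_ne_top]
        ring
    _ = _ := by
        rw [hnear₁, hnear₂, ENNReal.mul_rpow_of_nonneg _ _ (one_div_nonneg.2 hp.symm.nonneg),
          ENNReal.mul_rpow_of_nonneg _ _ (one_div_nonneg.2 hp.nonneg)]
        simp_rw [← ENNReal.rpow_mul]
        nth_rw 1 [hexp_t]
        rw [ENNReal.rpow_add _ _ hxy0 enorm_ne_top]
        ring

lemma steinWeissKernel_le_of_notMem_comparableRegion {α β t : ℝ} (ht : 0 ≤ t) {x y : E}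
    (hx : x ≠ 0) (hy : y ≠ 0) (hz : (x, y) ∉ comparableRegion E) :
    steinWeissKernel α β t x y ≤ 2 ^ t * (‖x‖ₑ ^ (-(β + t)) * nearKernel α ‖x‖ₑ y +
      nearKernel β ‖y‖ₑ x * ‖y‖ₑ ^ (-(α + t))) := by
  have hx0 : ‖x‖ₑ ≠ 0 := by simpa using hx
  have hy0 : ‖y‖ₑ ≠ 0 := by simpa using hy
  have hlt_of_two_mul : ∀ {a b : E}, 2 * ‖a‖ₑ < ‖b‖ₑ → ‖a‖ₑ < ‖b‖ₑ := fun h =>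
    (le_mul_of_one_le_left' one_le_two).trans_lt h
  by_cases hxy : 2 * ‖y‖ₑ < ‖x‖ₑ
  · have hnear : nearKernel α ‖x‖ₑ y = ‖y‖ₑ ^ (-α) :=
      Set.indicator_of_mem (by exact hlt_of_two_mul hxy) _
    rw [mul_add]
    refine le_add_right ?_
    calc ‖x‖ₑ ^ (-β) * ‖x - y‖ₑ ^ (-t) * ‖y‖ₑ ^ (-α)
        ≤ ‖x‖ₑ ^ (-β) * (2 ^ t * ‖x‖ₑ ^ (-t)) * ‖y‖ₑ ^ (-α) := by
          gcongr
          exact enorm_sub_rpow_le ht hxy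
      _ = 2 ^ t * (‖x‖ₑ ^ (-(β + t)) * nearKernel α ‖x‖ₑ y) := by
          rw [hnear, neg_add, ENNReal.rpow_add _ _ hx0 enorm_ne_top]
          ring
  · have hyx : 2 * ‖x‖ₑ < ‖y‖ₑ := not_le.1 fun h => hz ⟨not_lt.1 hxy, h⟩
    have hnear : nearKernel β ‖y‖ₑ x = ‖x‖ₑ ^ (-β) :=
      Set.indicator_of_mem (by exact hlt_of_two_mul hyx) _
    rw [mul_add]
    refine le_add_left ?_
    calc ‖x‖ₑ ^ (-β) * ‖x - y‖ₑ ^ (-t) * ‖y‖ₑ ^ (-α)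
        ≤ ‖x‖ₑ ^ (-β) * (2 ^ t * ‖y‖ₑ ^ (-t)) * ‖y‖ₑ ^ (-α) := by
          rw [enorm_sub_rev]
          gcongr
          exact enorm_sub_rpow_le ht hyx
      _ = 2 ^ t * (nearKernel β ‖y‖ₑ x * ‖y‖ₑ ^ (-(α + t))) := by
          rw [hnear, neg_add, ENNReal.rpow_add _ _ hy0 enorm_ne_top]
          ring

variable [MeasurableSpace E] [BorelSpace E]

lemma measurableSet_comparableRegion : MeasurableSet (comparableRegion E) :=
  (measurableSet_le measurable_fst.enorm (measurable_snd.enorm.const_mul 2)).inter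
    (measurableSet_le measurable_snd.enorm (measurable_fst.enorm.const_mul 2))

variable [NormedSpace ℝ E] [FiniteDimensional ℝ E]

lemma measurable_steinWeissKernel (α β t : ℝ) :
    Measurable fun z : E × E => steinWeissKernel α β t z.1 z.2 :=
  ((measurable_fst.enorm.pow_const _).mul
    ((measurable_fst.sub measurable_snd).enorm.pow_const _)).mul (measurable_snd.enorm.pow_const _)

variable (μ : Measure E) [μ.IsAddHaarMeasure] [Nontrivial E] {p p' q α β t : ℝ}

lemma exists_kernelBound_nearKernel_rpow_mul {a : ℝ} (hp : p.HolderConjugate p') (ha : 0 < a)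
    (hta : t + a = Module.finrank ℝ E) :
    ∃ C : ℝ≥0∞, C ≠ ⊤ ∧ KernelBound μ μ p p
      (fun x y => (nearKernel t (4 * ‖x‖ₑ) (x - y) * ‖x‖ₑ ^ (-a)) ^ (1 / p') *
        (nearKernel t (4 * ‖y‖ₑ) (x - y) * ‖y‖ₑ ^ (-a)) ^ (1 / p)) C := by
  obtain ⟨A, hA, hnear⟩ := exists_lintegral_nearKernel_eq μ (s := t) (by linarith)
  have hnorm : ∀ x : E, x ≠ 0 →
      (∫⁻ z, nearKernel t (4 * ‖x‖ₑ) z ∂μ) * ‖x‖ₑ ^ (-a) = A * 4 ^ a := fun x hx => by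
    have hx0 : ‖x‖ₑ ≠ 0 := by simpa using hx
    rw [hnear _ (mul_ne_zero (by simp) hx0) (by finiteness), ← hta, add_sub_cancel_left,
      ENNReal.mul_rpow_of_nonneg _ _ ha.le, mul_assoc, mul_assoc,
      ← ENNReal.rpow_add _ _ hx0 enorm_ne_top, add_neg_cancel, ENNReal.rpow_zero, mul_one]
  have hmeas : ∀ {g : E × E → E}, Measurable g → Measurable fun z : E × E =>
      nearKernel t (4 * ‖g z‖ₑ) (z.1 - z.2) * ‖g z‖ₑ ^ (-a) := fun hg =>
    (measurable_nearKernel t (hg.enorm.const_mul 4) (measurable_fst.sub measurable_snd)).mul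
      (hg.enorm.pow_const _)
  refine ⟨A * 4 ^ a, by finiteness, .of_lintegral_le hp (hmeas measurable_fst)
    (hmeas measurable_snd) ?_ ?_⟩
  · filter_upwards [Measure.ae_ne μ (0 : E)] with x hx
    rw [lintegral_mul_const _ (measurable_nearKernel t measurable_const (by fun_prop)),
      lintegral_sub_left_eq_self (nearKernel t (4 * ‖x‖ₑ)) x, hnorm x hx]
  · filter_upwards [Measure.ae_ne μ (0 : E)] with y hy
    rw [lintegral_mul_const _ (measurable_nearKernel t measurable_const (by fun_prop)),
      lintegral_sub_right_eq_self (nearKernel t (4 * ‖y‖ₑ)) y, hnorm y hy]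

lemma exists_kernelBound_steinWeissKernel_comparableRegion (hp : p.HolderConjugate p')
    (hpq : p ≤ q) (hαβ : 0 ≤ α + β) (htd : t < Module.finrank ℝ E)
    (hdeg : t + α + β = Module.finrank ℝ E * (1 / p' + 1 / q)) :
    ∃ C : ℝ≥0∞, C ≠ ⊤ ∧ KernelBound μ μ p q
      (fun x y => (comparableRegion E).indicator (fun z => steinWeissKernel α β t z.1 z.2) (x, y))
      C := by
  have hinv : 1 / p' = 1 - 1 / p := by simpa using hp.one_sub_inv.symm
  have hq : 0 < q := hp.pos.trans_le hpq
  rcases hpq.eq_or_lt with rfl | hlt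
  · have hd : t + (α + β) = Module.finrank ℝ E := by rw [← add_assoc, hdeg, hinv]; ring
    obtain ⟨C, hC, h⟩ := exists_kernelBound_nearKernel_rpow_mul μ hp (by linarith) hd
    refine ⟨2 ^ |-α + (α + β) / p| * C, by finiteness,
      h.of_ae_le_const_mul hq (by finiteness) ?_⟩
    filter_upwards [Measure.ae_ne μ 0] with x hx
    filter_upwards [Measure.ae_ne μ 0, Measure.ae_ne μ x] with y hy hyx
    exact Set.indicator_apply_le' (steinWeissKernel_le_nearKernel_rpow_mul hp hx hy hyx.symm)
      fun _ => zero_le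
  · obtain ⟨C, hC, h⟩ := exists_hardy_littlewood_sobolev μ hp.lt hlt
      (s := t + α + β) (by rw [hdeg, hinv])
    refine ⟨2 ^ |-α| * 3 ^ (α + β) * C, by finiteness, h.of_ae_le_const_mul hq (by finiteness) ?_⟩
    filter_upwards [Measure.ae_ne μ 0] with x hx
    filter_upwards [Measure.ae_ne μ x] with y hyx
    exact Set.indicator_apply_le' (steinWeissKernel_le_enorm_sub_rpow hαβ hx hyx.symm)
      fun _ => zero_le

theorem exists_stein_weiss (hp : p.HolderConjugate p') (hpq : p ≤ q) (hαβ : 0 ≤ α + β)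
    (hα : α < Module.finrank ℝ E / p') (hβ : β < Module.finrank ℝ E / q)
    (htd : t < Module.finrank ℝ E)
    (hdeg : t + α + β = Module.finrank ℝ E * (1 / p' + 1 / q)) :
    ∃ C : ℝ≥0∞, C ≠ ⊤ ∧ KernelBound μ μ p q (steinWeissKernel α β t) C := by
  have hq1 : 1 ≤ q := hp.lt.le.trans hpq
  have hdeg' : t + α + β = Module.finrank ℝ E / p' + Module.finrank ℝ E / q := by
    rw [hdeg]; ring
  have ht : 0 < t := by linarith
  obtain ⟨C₁, hC₁, h₁⟩ := exists_kernelBound_inner μ hp hpq (a := α) (b := β + t) (by linarith) hα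
  obtain ⟨C₂, hC₂, h₂⟩ := exists_kernelBound_outer μ hp hpq (a := α + t) (b := β) (by linarith) hβ
  obtain ⟨C₃, hC₃, h₃⟩ :=
    exists_kernelBound_steinWeissKernel_comparableRegion μ hp hpq hαβ htd hdeg
  have hinner : Measurable (Function.uncurry fun x y : E =>
      ‖x‖ₑ ^ (-(β + t)) * nearKernel α ‖x‖ₑ y) :=
    (measurable_fst.enorm.pow_const _).mul
      (measurable_nearKernel α measurable_fst.enorm measurable_snd)
  have houter : Measurable (Function.uncurry fun x y : E =>
      nearKernel β ‖y‖ₑ x * ‖y‖ₑ ^ (-(α + t))) :=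
    (measurable_nearKernel β measurable_snd.enorm measurable_fst).mul
      (measurable_snd.enorm.pow_const _)
  have hcomparable : Measurable (Function.uncurry fun x y : E =>
      (comparableRegion E).indicator (fun z => steinWeissKernel α β t z.1 z.2) (x, y)) :=
    (measurable_steinWeissKernel α β t).indicator measurableSet_comparableRegion
  have hsum := KernelBound.add hq1 (hinner.add houter) (.add hq1 hinner h₁ houter h₂)
    hcomparable h₃
  refine ⟨(1 + 2 ^ t) * (C₁ + C₂ + C₃), by finiteness,
    hsum.of_ae_le_const_mul (by linarith) (by finiteness) ?_⟩
  filter_upwards [Measure.ae_ne μ (0 : E)] with x hx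
  filter_upwards [Measure.ae_ne μ (0 : E)] with y hy
  by_cases hz : (x, y) ∈ comparableRegion E
  · rw [Set.indicator_of_mem hz]
    exact (le_add_left le_rfl).trans (le_mul_of_one_le_left' le_self_add)
  · exact (steinWeissKernel_le_of_notMem_comparableRegion ht.le hx hy hz).trans
      (mul_le_mul' le_add_self le_self_add)

end SteinWeiss

section Product

variable {X Y Z W : Type*} [MeasurableSpace X] [MeasurableSpace Y] [MeasurableSpace Z]
  [MeasurableSpace W] {μ : Measure X} {ν : Measure Y} {μ' : Measure Z} {ν' : Measure W} {p q : ℝ}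

lemma eLpNorm'_prod [SFinite μ] [SFinite μ'] (hp : 0 < p) {f : X × Z → ℝ≥0∞} (hf : Measurable f) :
    eLpNorm' f p (μ.prod μ') = eLpNorm' (fun z => eLpNorm' (fun x => f (x, z)) p μ) p μ' := by
  simp_rw [eLpNorm'_eq_lintegral_enorm, enorm_eq_self, ← ENNReal.rpow_mul,
    one_div_mul_cancel hp.ne', ENNReal.rpow_one]
  rw [lintegral_prod_symm _ (hf.pow_const p).aemeasurable]

lemma KernelBound.prod [SigmaFinite μ] [SFinite ν] [SFinite μ'] [SFinite ν'] (hp : 0 < p)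
    (hq : 1 ≤ q) {K : X × Z → Y × W → ℝ≥0∞} (hK : Measurable (Function.uncurry K))
    {k : Z → W → ℝ≥0∞} {C : ℝ≥0∞}
    (hfiber : ∀ᵐ z ∂μ', ∀ᵐ w ∂ν', KernelBound μ ν p q (fun x y => K (x, z) (y, w)) (k z w))
    (hk : KernelBound μ' ν' p q k C) : KernelBound (μ.prod μ') (ν.prod ν') p q K C := fun f hf => by
  have hq0 : 0 < q := by linarith
  have hKf : Measurable fun u : (X × Z) × Y × W => K u.1 u.2 * f u.2 :=
    hK.mul (hf.comp measurable_snd)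
  have hfnorm : Measurable fun w => eLpNorm' (fun y => f (y, w)) p ν :=
    (hf.pow_const p).lintegral_prod_left'.pow_const _
  rw [eLpNorm'_prod hq0 hKf.lintegral_prod_right', eLpNorm'_prod hp hf]
  refine (eLpNorm'_mono_enorm_ae hq0.le ?_).trans (hk _ hfnorm)
  filter_upwards [hfiber] with z hz
  simp_rw [enorm_eq_self]
  have hKz : Measurable fun u : (X × W) × Y => K (u.1.1, z) (u.2, u.1.2) * f (u.2, u.1.2) :=
    hKf.comp (by fun_prop : Measurable fun u : (X × W) × Y => ((u.1.1, z), u.2, u.1.2))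
  calc eLpNorm' (fun x => ∫⁻ u, K (x, z) u * f u ∂ν.prod ν') q μ
      = eLpNorm' (fun x => ∫⁻ w, ∫⁻ y, K (x, z) (y, w) * f (y, w) ∂ν ∂ν') q μ := by
        congr 1 with x
        exact lintegral_prod_symm _ (hKf.comp measurable_prodMk_left).aemeasurable
    _ ≤ ∫⁻ w, eLpNorm' (fun x => ∫⁻ y, K (x, z) (y, w) * f (y, w) ∂ν) q μ ∂ν' :=
        eLpNorm'_lintegral_le hq hKz.lintegral_prod_right'
    _ ≤ ∫⁻ w, k z w * eLpNorm' (fun y => f (y, w)) p ν ∂ν' := by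
        refine lintegral_mono_ae ?_
        filter_upwards [hz] with w hw
        exact hw _ (hf.comp measurable_prodMk_right)

lemma KernelBound.comp_measurePreserving {e : X ≃ᵐ Y} (he : MeasurePreserving e μ ν)
    {k : Y → Y → ℝ≥0∞} {C : ℝ≥0∞} [SFinite ν] (hk : Measurable (Function.uncurry k))
    (h : KernelBound ν ν p q k C) : KernelBound μ μ p q (fun x y => k (e x) (e y)) C := by
  intro f hf
  have hfe : Measurable fun y => f (e.symm y) := hf.comp e.symm.measurable
  have hf_eq : eLpNorm' f p μ = eLpNorm' (fun y => f (e.symm y)) p ν := by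
    simpa using eLpNorm'_comp_measurePreserving (p := p) he hfe
  have hint : ∀ x, ∫⁻ y, k (e x) (e y) * f y ∂μ = ∫⁻ y, k (e x) y * f (e.symm y) ∂ν := fun x => by
    rw [← he.lintegral_comp_emb e.measurableEmbedding]
    simp
  have hkf : Measurable fun u : Y × Y => k u.1 u.2 * f (e.symm u.2) :=
    hk.mul (hfe.comp measurable_snd)
  simp_rw [hint]
  rw [eLpNorm'_comp_measurePreserving he hkf.lintegral_prod_right', hf_eq]
  exact h _ hfe

lemma kernelBound_one [IsFiniteMeasure μ] [IsFiniteMeasure ν] {p' : ℝ} (hp : p.HolderConjugate p')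
    (hpq : p ≤ q) :
    KernelBound μ ν p q (fun _ _ => 1) (ν Set.univ ^ (1 / p') * μ Set.univ ^ (1 / q)) := by
  simpa using KernelBound.of_mul (μ := μ) (ν := ν) hp hpq (K₁ := fun _ _ => 1) (K₂ := fun _ _ => 1)
    measurable_const measurable_const (A := fun _ => ν Set.univ ^ (1 / p')) measurable_const
    (.of_forall fun _ => by simp [eLpNorm'_const _ hp.symm.pos])
    (.of_forall fun _ => by simp [eLpNorm'_const _ (hp.pos.trans_le hpq)])

end Product

section Fiber

variable {E H : Type*} [NormedAddCommGroup E] [NormedAddCommGroup H]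

lemma enorm_fst_le (x : E) (z : H) : ‖x‖ₑ ≤ ‖(x, z)‖ₑ :=
  enorm_le_iff_norm_le.2 (norm_fst_le (x, z))

lemma enorm_snd_le (x : E) (z : H) : ‖z‖ₑ ≤ ‖(x, z)‖ₑ :=
  enorm_le_iff_norm_le.2 (norm_snd_le (x, z))

variable [NormedSpace ℝ E] [FiniteDimensional ℝ E]
  [MeasurableSpace E] [BorelSpace E] (μ : Measure E) [μ.IsAddHaarMeasure] {p p' q s t : ℝ}

lemma kernelBound_sub (hp : p.HolderConjugate p') {g : E → ℝ≥0∞} (hg : Measurable g) :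
    KernelBound μ μ p p (fun x y => g (x - y)) (∫⁻ z, g z ∂μ) := by
  have hinv : 1 / p' + 1 / p = 1 := by simpa [add_comm] using hp.inv_add_inv_eq_one
  have hgm : Measurable (Function.uncurry fun x y => g (x - y)) :=
    hg.comp (measurable_fst.sub measurable_snd)
  have hpow : ∀ a : ℝ≥0∞, a ^ (1 / p') * a ^ (1 / p) = a := fun a => by
    rw [← ENNReal.rpow_add_of_nonneg _ _ (one_div_nonneg.2 hp.symm.nonneg)
      (one_div_nonneg.2 hp.nonneg), hinv, ENNReal.rpow_one]
  have h := KernelBound.of_lintegral_le (μ := μ) (ν := μ) hp hgm hgm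
    (.of_forall fun x => (lintegral_sub_left_eq_self g x).le)
    (.of_forall fun y => (lintegral_sub_right_eq_self g y).le)
  simpa only [hpow] using h

lemma exists_kernelBound_enorm_sub_rpow (hp : p.HolderConjugate p') (hpq : p < q)
    (hs : s = Module.finrank ℝ E * (1 - 1 / p + 1 / q)) :
    ∃ C : ℝ≥0∞, C ≠ ⊤ ∧ KernelBound μ μ p q (fun x y => ‖x - y‖ₑ ^ (-s)) C := by
  rcases subsingleton_or_nontrivial E with hE | hE
  · have hs0 : s = 0 := by rw [hs, Module.finrank_zero_of_subsingleton]; simp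
    have : IsFiniteMeasure μ := inferInstance
    have hp'0 := hp.symm.nonneg
    have hq0 : 0 ≤ q := hp.nonneg.trans hpq.le
    refine ⟨_, ?_, by simpa [hs0] using kernelBound_one (μ := μ) (ν := μ) hp hpq.le⟩
    finiteness
  · exact exists_hardy_littlewood_sobolev μ hp.lt hpq hs

lemma exists_fiber_kernelBound_of_lt (hp : p.HolderConjugate p') (hpq : p < q)
    (hs : s = Module.finrank ℝ E * (1 - 1 / p + 1 / q)) (ht : 0 ≤ t) :
    ∃ C : ℝ≥0∞, C ≠ ⊤ ∧ ∀ z : H, z ≠ 0 →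
      KernelBound μ μ p q (fun x y => ‖(x - y, z)‖ₑ ^ (-(s + t))) (‖z‖ₑ ^ (-t) * C) := by
  have hq : 0 < q := hp.pos.trans hpq
  have hs0 : 0 ≤ s := by
    have : 1 / p ≤ 1 := (div_le_one hp.pos).2 hp.lt.le
    have : 0 ≤ 1 / q := by positivity
    exact hs ▸ mul_nonneg (by positivity) (by linarith)
  obtain ⟨C, hC, h⟩ := exists_kernelBound_enorm_sub_rpow μ hp hpq hs
  refine ⟨C, hC, fun z hz => ?_⟩
  have hz0 : ‖z‖ₑ ≠ 0 := by simpa using hz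
  refine h.of_ae_le_const_mul hq (ENNReal.rpow_ne_top_of_ne_zero hz0 enorm_ne_top)
    (.of_forall fun x => .of_forall fun y => ?_)
  have hxyz : ‖(x - y, z)‖ₑ ≠ 0 := by simp [hz]
  rw [neg_add, add_comm, ENNReal.rpow_add _ _ hxyz enorm_ne_top]
  exact mul_le_mul' (ennreal_rpow_le_rpow_of_nonpos (by linarith) (enorm_snd_le _ _))
    (ennreal_rpow_le_rpow_of_nonpos (by linarith) (enorm_fst_le _ _))

lemma exists_fiber_kernelBound_self (hp : p.HolderConjugate p') (ht : 0 < t) :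
    ∃ C : ℝ≥0∞, C ≠ ⊤ ∧ ∀ z : H, z ≠ 0 → KernelBound μ μ p p
      (fun x y => ‖(x - y, z)‖ₑ ^ (-(Module.finrank ℝ E + t))) (‖z‖ₑ ^ (-t) * C) := by
  set d : ℝ := (Module.finrank ℝ E : ℝ)
  have hd : 0 ≤ d := by positivity
  obtain ⟨C, hC, h⟩ := exists_lintegral_enorm_add_rpow_eq μ (a := -(d + t)) (by linarith)
  refine ⟨2 ^ (d + t) * C, by finiteness, fun z hz f hf => ?_⟩
  have hz0 : ‖z‖ₑ ≠ 0 := by simpa using hz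
  have hmeas : Measurable fun x : E => ‖(x, z)‖ₑ ^ (-(d + t)) := by
    have : Continuous fun x : E => (x, z) := by fun_prop
    exact this.enorm.measurable.pow_const _
  refine (kernelBound_sub μ hp hmeas f hf).trans (mul_le_mul_left ?_ _)
  calc ∫⁻ x : E, ‖(x, z)‖ₑ ^ (-(d + t)) ∂μ
      ≤ ∫⁻ x : E, 2 ^ (d + t) * (‖x‖ₑ + ‖z‖ₑ) ^ (-(d + t)) ∂μ := by
        refine lintegral_mono fun x => ennreal_rpow_neg_le_mul (by linarith) (by simp) (by simp)
          enorm_ne_top ?_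
        rw [two_mul]
        exact add_le_add (enorm_fst_le _ _) (enorm_snd_le _ _)
    _ = ‖z‖ₑ ^ (-t) * (2 ^ (d + t) * C) := by
        rw [lintegral_const_mul' _ _ (by finiteness), h _ hz0 enorm_ne_top, neg_add,
          add_neg_cancel_left]
        ring

lemma exists_fiber_kernelBound (hp : p.HolderConjugate p') (hpq : p ≤ q)
    (hs : s = Module.finrank ℝ E * (1 - 1 / p + 1 / q)) (ht : 0 < t) :
    ∃ C : ℝ≥0∞, C ≠ ⊤ ∧ ∀ z : H, z ≠ 0 →
      KernelBound μ μ p q (fun x y => ‖(x - y, z)‖ₑ ^ (-(s + t))) (‖z‖ₑ ^ (-t) * C) := by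
  rcases hpq.eq_or_lt with rfl | hlt
  · rw [sub_add_cancel, mul_one] at hs
    exact hs ▸ exists_fiber_kernelBound_self μ hp ht
  · exact exists_fiber_kernelBound_of_lt μ hp hlt hs ht.le

end Fiber

section PartialSteinWeiss

variable {E H : Type*} [NormedAddCommGroup E] [NormedSpace ℝ E] [FiniteDimensional ℝ E]
  [MeasurableSpace E] [BorelSpace E] (μ : Measure E) [μ.IsAddHaarMeasure]
  [NormedAddCommGroup H] [NormedSpace ℝ H] [FiniteDimensional ℝ H]
  [MeasurableSpace H] [BorelSpace H] (ν : Measure H) [ν.IsAddHaarMeasure]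
  {p p' q s t α β γ : ℝ}

/-- The Riesz kernel `‖X - Y‖ ^ (-s)` on `E × H` with weights in the `H` components only. -/
def partialSteinWeissKernel (α β s : ℝ) (X Y : E × H) : ℝ≥0∞ :=
  ‖X.2‖ₑ ^ (-β) * ‖X - Y‖ₑ ^ (-s) * ‖Y.2‖ₑ ^ (-α)

lemma measurable_partialSteinWeissKernel (α β s : ℝ) :
    Measurable (Function.uncurry (partialSteinWeissKernel (E := E) (H := H) α β s)) :=
  ((measurable_fst.snd.enorm.pow_const _).mul
    ((measurable_fst.sub measurable_snd).enorm.pow_const _)).mul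
    (measurable_snd.snd.enorm.pow_const _)

lemma exists_kernelBound_partialSteinWeissKernel [Nontrivial H] (hp : p.HolderConjugate p')
    (hpq : p ≤ q) (hαβ : 0 ≤ α + β) (hα : α < Module.finrank ℝ H / p')
    (hβ : β < Module.finrank ℝ H / q) (hs : s = Module.finrank ℝ E * (1 - 1 / p + 1 / q))
    (ht : 0 < t) (htH : t < Module.finrank ℝ H)
    (hdeg : t + α + β = Module.finrank ℝ H * (1 / p' + 1 / q)) :
    ∃ C : ℝ≥0∞, C ≠ ⊤ ∧
      KernelBound (μ.prod ν) (μ.prod ν) p q (partialSteinWeissKernel α β (s + t)) C := by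
  have hq : 0 < q := hp.pos.trans_le hpq
  obtain ⟨C₁, hC₁, hfiber⟩ := exists_fiber_kernelBound (H := H) μ hp hpq hs ht
  obtain ⟨C₂, hC₂, hbase⟩ := exists_stein_weiss ν hp hpq hαβ hα hβ htH hdeg
  refine ⟨C₁ * C₂, by finiteness, .prod hp.pos (hp.lt.le.trans hpq)
    (measurable_partialSteinWeissKernel α β (s + t))
    (k := fun z w => C₁ * steinWeissKernel α β t z w) ?_
    (hbase.of_ae_le_const_mul hq hC₁ (.of_forall fun _ => .of_forall fun _ => le_rfl))⟩
  filter_upwards [Measure.ae_ne ν (0 : H)] with z hz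
  filter_upwards [Measure.ae_ne ν (0 : H), Measure.ae_ne ν z] with w hw hwz
  have hweights : ‖z‖ₑ ^ (-β) * ‖w‖ₑ ^ (-α) ≠ ⊤ :=
    ENNReal.mul_ne_top (ENNReal.rpow_ne_top_of_ne_zero (by simpa using hz) enorm_ne_top)
      (ENNReal.rpow_ne_top_of_ne_zero (by simpa using hw) enorm_ne_top)
  have h := (hfiber (z - w) (sub_ne_zero.2 hwz.symm)).of_ae_le_const_mul hq hweights
    (k' := fun x y => partialSteinWeissKernel α β (s + t) (x, z) (y, w))
    (.of_forall fun x => .of_forall fun y => (mul_right_comm _ _ _).le)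
  convert h using 1
  simp only [steinWeissKernel]
  ring

theorem exists_partial_stein_weiss [Nontrivial H] (hp : p.HolderConjugate p') (hpq : p ≤ q)
    (hαβ : 0 ≤ α + β) (hα : α < Module.finrank ℝ H / p') (hβ : β < Module.finrank ℝ H / q)
    (hγ : 0 < γ)
    (hdeg : 1 / q = 1 / p + (α + β - γ) / (Module.finrank ℝ E + Module.finrank ℝ H)) :
    ∃ C : ℝ≥0∞, C ≠ ⊤ ∧ KernelBound (μ.prod ν) (μ.prod ν) p q
      (partialSteinWeissKernel α β (Module.finrank ℝ E + Module.finrank ℝ H - γ)) C := by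
  have hinv : 1 / p' = 1 - 1 / p := by simpa using hp.one_sub_inv.symm
  have hH : (0 : ℝ) < Module.finrank ℝ H := mod_cast Module.finrank_pos (R := ℝ) (M := H)
  set d : ℝ := (Module.finrank ℝ E : ℝ)
  set e : ℝ := (Module.finrank ℝ H : ℝ)
  have hdeg' : (d + e) * (1 / q - 1 / p) = α + β - γ := by
    rw [hdeg, add_sub_cancel_left, mul_div_cancel₀ _ (by positivity)]
  set t : ℝ := e * (1 / p' + 1 / q) - (α + β) with ht
  have ht0 : 0 < t := by
    have : e * (1 / p' + 1 / q) = e / p' + e / q := by ring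
    linarith
  have hte : t < e := by
    have hle : 1 / q ≤ 1 / p := one_div_le_one_div_of_le hp.pos hpq
    rw [ht, hinv]
    rcases hpq.eq_or_lt with rfl | hlt
    · nlinarith
    · have : 1 / q < 1 / p := one_div_lt_one_div_of_lt hp.pos hlt
      nlinarith
  have hst : d + e - γ = d * (1 - 1 / p + 1 / q) + t := by
    rw [ht, hinv]; linear_combination -hdeg'
  rw [hst]
  exact exists_kernelBound_partialSteinWeissKernel μ ν hp hpq hαβ hα hβ rfl ht0 hte
    (by rw [ht]; ring)

end PartialSteinWeiss

section Space

variable {n m : ℕ}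

/-- The splitting of `ℝ^{n+m}` into its components `(x, x̂)`; it is not isometric, as the product
carries the maximum norm. -/
def splitEquiv (n m : ℕ) :
    Space n m ≃ᵐ EuclideanSpace ℝ (Fin n) × EuclideanSpace ℝ (Fin m) :=
  (PiLp.sumPiLpEquivProdLpPiLp (𝕜 := ℝ) 2 (fun _ : Fin n ⊕ Fin m => ℝ)).toMeasurableEquiv.trans
    (MeasurableEquiv.toLp 2 _).symm

lemma measurePreserving_splitEquiv (n m : ℕ) : MeasurePreserving (splitEquiv n m) :=
  (LinearIsometryEquiv.measurePreserving _).trans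
    (WithLp.volume_preserving_symm_measurableEquiv_toLp_prod _ _)

lemma splitEquiv_snd (X : Space n m) : (splitEquiv n m X).2 = hat X := rfl

lemma splitEquiv_sub (X Y : Space n m) :
    splitEquiv n m (X - Y) = splitEquiv n m X - splitEquiv n m Y := rfl

lemma enorm_splitEquiv_le (X : Space n m) : ‖splitEquiv n m X‖ₑ ≤ ‖X‖ₑ := by
  rw [enorm_le_iff_norm_le,
    ← (PiLp.sumPiLpEquivProdLpPiLp (𝕜 := ℝ) 2 fun _ : Fin n ⊕ Fin m => ℝ).norm_map X]
  exact max_le (WithLp.norm_fst_le _ _) (WithLp.norm_snd_le _ _)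

lemma measurable_hat : Measurable (hat : Space n m → EuclideanSpace ℝ (Fin m)) :=
  measurable_snd.comp (splitEquiv n m).measurable

lemma nontrivial_euclideanSpace_fin (hm : 0 < m) : Nontrivial (EuclideanSpace ℝ (Fin m)) :=
  have : Nonempty (Fin m) := ⟨⟨0, hm⟩⟩
  inferInstance

lemma ae_hat_ne_zero (hm : 0 < m) : ∀ᵐ X : Space n m, hat X ≠ 0 := by
  have := nontrivial_euclideanSpace_fin hm
  have h : ∀ᵐ z : EuclideanSpace ℝ (Fin n) × EuclideanSpace ℝ (Fin m), z.2 ≠ 0 :=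
    Measure.quasiMeasurePreserving_snd.ae (Measure.ae_ne volume 0)
  exact (measurePreserving_splitEquiv n m).quasiMeasurePreserving.ae h

variable {p q α β γ : ℝ}

lemma exists_kernelBound_hat (hp : 1 < p) (hpq : p ≤ q) (hm : 0 < m)
    (hαβ : 0 ≤ α + β) (hα : α < m / Real.conjExponent p) (hβ : β < m / q) (hγ : 0 < γ)
    (hγ' : γ < n + m) (hdeg : 1 / q = 1 / p + (α + β - γ) / (n + m)) :
    ∃ C : ℝ≥0∞, C ≠ ⊤ ∧ KernelBound (volume : Measure (Space n m)) volume p q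
      (fun X Y => ‖hat X‖ₑ ^ (-β) * ‖X - Y‖ₑ ^ (-(n + m - γ)) * ‖hat Y‖ₑ ^ (-α)) C := by
  have := nontrivial_euclideanSpace_fin hm
  obtain ⟨C, hC, h⟩ := exists_partial_stein_weiss (volume : Measure (EuclideanSpace ℝ (Fin n)))
    (volume : Measure (EuclideanSpace ℝ (Fin m))) (Real.HolderConjugate.conjExponent hp) hpq hαβ
    (by simpa using hα) (by simpa using hβ) hγ (by simpa using hdeg)
  simp only [finrank_euclideanSpace, Fintype.card_fin] at h
  have hsplit := h.comp_measurePreserving (measurePreserving_splitEquiv n m)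
    (measurable_partialSteinWeissKernel α β _)
  have hle : ∀ X Y : Space n m, ‖hat X‖ₑ ^ (-β) * ‖X - Y‖ₑ ^ (-(n + m - γ)) * ‖hat Y‖ₑ ^ (-α) ≤
      1 * partialSteinWeissKernel α β (n + m - γ) (splitEquiv n m X) (splitEquiv n m Y) :=
    fun X Y => by
      rw [one_mul, partialSteinWeissKernel, splitEquiv_snd, splitEquiv_snd, ← splitEquiv_sub]
      exact mul_le_mul_left (mul_le_mul_right
        (ennreal_rpow_le_rpow_of_nonpos (by linarith) (enorm_splitEquiv_le _)) _) _
  exact ⟨1 * C, by finiteness, hsplit.of_ae_le_const_mul (by linarith) ENNReal.one_ne_top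
    (.of_forall fun X => .of_forall (hle X))⟩

theorem exists_stein_weiss_hat (hp : 1 < p) (hpq : p ≤ q) (hm : 0 < m)
    (hαβ : 0 ≤ α + β) (hα : α < m / Real.conjExponent p) (hβ : β < m / q) (hγ : 0 < γ)
    (hγ' : γ < n + m) (hdeg : 1 / q = 1 / p + (α + β - γ) / (n + m)) :
    ∃ C : ℝ≥0∞, C ≠ ⊤ ∧ ∀ F : Space n m → ℝ≥0∞, Measurable F →
      eLpNorm' (fun X => ‖hat X‖ₑ ^ (-β) * rieszPotential volume (n + m - γ) F X) q volume ≤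
        C * eLpNorm' (fun Y => ‖hat Y‖ₑ ^ α * F Y) p volume := by
  obtain ⟨C, hC, h⟩ := exists_kernelBound_hat hp hpq hm hαβ hα hβ hγ hγ' hdeg
  refine ⟨C, hC, fun F hF => ?_⟩
  have hαF : Measurable fun Y : Space n m => ‖hat Y‖ₑ ^ α * F Y :=
    (measurable_hat.enorm.pow_const α).mul hF
  refine (eLpNorm'_mono_enorm_ae (by linarith) ?_).trans (h _ hαF)
  filter_upwards [ae_hat_ne_zero hm] with X hX
  simp_rw [enorm_eq_self, rieszPotential]
  rw [← lintegral_const_mul' _ _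
    (ENNReal.rpow_ne_top_of_ne_zero (by simpa using hX) enorm_ne_top)]
  refine lintegral_mono_ae ?_
  filter_upwards [ae_hat_ne_zero hm] with Y hY
  have hcancel : ‖hat Y‖ₑ ^ (-α) * ‖hat Y‖ₑ ^ α = 1 := by
    rw [← ENNReal.rpow_add _ _ (by simpa using hY) enorm_ne_top, neg_add_cancel,
      ENNReal.rpow_zero]
  rw [mul_assoc _ (‖hat Y‖ₑ ^ (-α)), ← mul_assoc (‖hat Y‖ₑ ^ (-α)), hcancel, one_mul, mul_assoc]

end Space

section GradientRepresentation

variable {E : Type*} [NormedAddCommGroup E] [NormedSpace ℝ E]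

lemma enorm_le_lintegral_ray {φ : E → ℝ} (hφ : ContDiff ℝ 1 φ) (hs : HasCompactSupport φ) (x : E)
    {w : E} (hw : w ≠ 0) :
    ‖φ x‖ₑ ≤ ∫⁻ t in Set.Ioi (0 : ℝ), ‖fderiv ℝ φ (x + t • w)‖ₑ * ‖w‖ₑ := by
  set f : ℝ → ℝ := fun t => φ (x + t • w) with hf
  have hline : Topology.IsClosedEmbedding fun t : ℝ => x + t • w :=
    (Homeomorph.addLeft x).isClosedEmbedding.comp (isClosedEmbedding_smul_left hw)
  have hfderiv : ∀ t, deriv f t = fderiv ℝ φ (x + t • w) w := fun t => by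
    have hray : HasDerivAt (fun t : ℝ => x + t • w) w t := by
      simpa using ((hasDerivAt_id t).smul_const w).const_add x
    exact ((hφ.differentiable one_ne_zero _).hasFDerivAt.comp_hasDerivAt t hray).deriv
  have hftc : ∫ t in Set.Ioi (0 : ℝ), deriv f t = -f 0 :=
    (hs.comp_isClosedEmbedding hline).integral_Ioi_deriv_eq (hφ.comp (by fun_prop)) 0
  calc ‖φ x‖ₑ = ‖∫ t in Set.Ioi (0 : ℝ), deriv f t‖ₑ := by rw [hftc, enorm_neg]; simp [hf]
    _ ≤ ∫⁻ t in Set.Ioi (0 : ℝ), ‖deriv f t‖ₑ := enorm_integral_le_lintegral_enorm _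
    _ ≤ ∫⁻ t in Set.Ioi (0 : ℝ), ‖fderiv ℝ φ (x + t • w)‖ₑ * ‖w‖ₑ :=
      lintegral_mono fun t => by rw [hfderiv]; exact ContinuousLinearMap.le_opENorm _ _

variable [FiniteDimensional ℝ E] [Nontrivial E] [MeasurableSpace E] [BorelSpace E]
  (μ : Measure E) [μ.IsAddHaarMeasure]

lemma lintegral_eq_lintegral_sphere {f : E → ℝ≥0∞} (hf : Measurable f) :
    ∫⁻ x, f x ∂μ = ∫⁻ θ : Metric.sphere (0 : E) 1, (∫⁻ t in Set.Ioi (0 : ℝ),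
      ENNReal.ofReal (t ^ (Module.finrank ℝ E - 1)) * f (t • (θ : E))) ∂μ.toSphere := by
  set k := Module.finrank ℝ E - 1
  have hfsmul : Measurable fun u : Metric.sphere (0 : E) 1 × Set.Ioi (0 : ℝ) =>
      f ((u.2 : ℝ) • (u.1 : E)) := hf.comp (by fun_prop)
  calc ∫⁻ x, f x ∂μ = ∫⁻ x : ({0}ᶜ : Set E), f x ∂μ.comap (↑) := by
        rw [lintegral_subtype_comap (measurableSet_singleton _).compl,
          Measure.restrict_eq_self_of_ae_mem]
        exact Measure.ae_ne μ 0
    _ = ∫⁻ u, f ((u.2 : ℝ) • (u.1 : E)) ∂μ.toSphere.prod (Measure.volumeIoiPow k) := by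
        rw [← μ.measurePreserving_homeomorphUnitSphereProd.lintegral_comp hfsmul]
        refine lintegral_congr fun x => ?_
        rw [← homeomorphUnitSphereProd_symm_apply_coe, Homeomorph.symm_apply_apply]
    _ = ∫⁻ θ : Metric.sphere (0 : E) 1, ∫⁻ t : Set.Ioi (0 : ℝ),
          f ((t : ℝ) • (θ : E)) ∂Measure.volumeIoiPow k ∂μ.toSphere :=
        lintegral_prod _ hfsmul.aemeasurable
    _ = ∫⁻ θ : Metric.sphere (0 : E) 1, (∫⁻ t in Set.Ioi (0 : ℝ),
          ENNReal.ofReal (t ^ k) * f (t • (θ : E))) ∂μ.toSphere := by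
        refine lintegral_congr fun θ => ?_
        rw [← lintegral_subtype_comap measurableSet_Ioi, Measure.volumeIoiPow]
        exact lintegral_withDensity_eq_lintegral_mul _ (by fun_prop) (hf.comp (by fun_prop))

/-- In polar coordinates the kernel of order one cancels the Jacobian. -/
lemma rieszPotential_finrank_sub_one {g : E → ℝ≥0∞} (hg : Measurable g) (x : E) :
    rieszPotential μ (Module.finrank ℝ E - 1) g x =
      ∫⁻ θ : Metric.sphere (0 : E) 1, (∫⁻ t in Set.Ioi (0 : ℝ), g (x + t • (θ : E)))
        ∂μ.toSphere := by
  have hpos : 1 ≤ Module.finrank ℝ E := Module.finrank_pos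
  set k := Module.finrank ℝ E - 1 with hk
  have hkd : (Module.finrank ℝ E : ℝ) - 1 = k := by rw [hk, Nat.cast_sub hpos, Nat.cast_one]
  have hcancel : ∀ θ : Metric.sphere (0 : E) 1, ∀ t ∈ Set.Ioi (0 : ℝ),
      ENNReal.ofReal (t ^ k) * (‖t • (θ : E)‖ₑ ^ (-(k : ℝ)) * g (x + t • (θ : E))) =
        g (x + t • (θ : E)) := fun θ t (ht : 0 < t) => by
    have hθ : ‖(θ : E)‖ₑ = 1 := by rw [← ofReal_norm, norm_eq_of_mem_sphere, ENNReal.ofReal_one]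
    rw [enorm_smul_of_pos ht, hθ, mul_one, ENNReal.ofReal_pow ht.le, ← ENNReal.rpow_natCast,
      ← mul_assoc, ← ENNReal.rpow_add _ _ (by simpa using ht) ENNReal.ofReal_ne_top,
      add_neg_cancel, ENNReal.rpow_zero, one_mul]
  calc rieszPotential μ (Module.finrank ℝ E - 1) g x
      = ∫⁻ y, ‖y‖ₑ ^ (-(k : ℝ)) * g (x + y) ∂μ := by
        rw [rieszPotential, hkd, ← lintegral_add_left_eq_self _ x]
        simp
    _ = ∫⁻ θ : Metric.sphere (0 : E) 1, (∫⁻ t in Set.Ioi (0 : ℝ), ENNReal.ofReal (t ^ k) *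
          (‖t • (θ : E)‖ₑ ^ (-(k : ℝ)) * g (x + t • (θ : E)))) ∂μ.toSphere :=
        lintegral_eq_lintegral_sphere μ
          ((measurable_enorm.pow_const _).mul (hg.comp (measurable_const_add x)))
    _ = ∫⁻ θ : Metric.sphere (0 : E) 1, (∫⁻ t in Set.Ioi (0 : ℝ), g (x + t • (θ : E)))
          ∂μ.toSphere :=
        lintegral_congr fun θ => setLIntegral_congr_fun measurableSet_Ioi (hcancel θ)

theorem toSphere_mul_enorm_le_rieszPotential_fderiv {φ : E → ℝ} (hφ : ContDiff ℝ 1 φ)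
    (hs : HasCompactSupport φ) (x : E) : μ.toSphere Set.univ * ‖φ x‖ₑ ≤
      rieszPotential μ (Module.finrank ℝ E - 1) (fun y => ‖fderiv ℝ φ y‖ₑ) x := by
  rw [rieszPotential_finrank_sub_one μ (hφ.continuous_fderiv one_ne_zero).enorm.measurable,
    mul_comm, ← lintegral_const]
  refine lintegral_mono fun θ => ?_
  have hθ : ‖(θ : E)‖ₑ = 1 := by rw [← ofReal_norm, norm_eq_of_mem_sphere, ENNReal.ofReal_one]
  simpa [hθ] using enorm_le_lintegral_ray hφ hs x (ne_zero_of_mem_unit_sphere θ)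

end GradientRepresentation

section Subordination

/-- The integrand in `b` of the subordination formula
`∫₀^∞ (2r)^γ b^(-γ/2-1) exp(-r²/b) db = 2^γ Γ(γ/2)`, which exhibits the symbol `(2r)^(-γ)` of a
Riesz potential as a superposition of Gaussians in `r`. -/
def subordinationKernel (γ b r : ℝ) : ℝ :=
  (2 * r) ^ γ * (b ^ (-γ / 2 - 1) * Real.exp (-(r ^ 2 / b)))

variable {γ : ℝ}

lemma subordinationKernel_nonneg {b r : ℝ} (hb : 0 ≤ b) (hr : 0 ≤ r) :
    0 ≤ subordinationKernel γ b r := by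
  unfold subordinationKernel
  positivity

lemma integral_subordinationKernel (hγ : 0 < γ) {r : ℝ} (hr : 0 < r) :
    ∫ b in Set.Ioi (0 : ℝ), subordinationKernel γ b r = 2 ^ γ * Real.Gamma (γ / 2) := by
  set g : ℝ → ℝ := fun t => t ^ (γ / 2 - 1) * Real.exp (-(r ^ 2 * t))
  have hg : ∫ t in Set.Ioi (0 : ℝ), g t = r ^ (-γ) * Real.Gamma (γ / 2) := by
    rw [Real.integral_rpow_mul_exp_neg_mul_Ioi (by positivity) (by positivity),
      one_div, ← Real.rpow_natCast, ← Real.rpow_neg hr.le, ← Real.rpow_mul hr.le]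
    congr 2
    push_cast
    ring
  have hinv : ∀ b ∈ Set.Ioi (0 : ℝ), (|(-1 : ℝ)| * b ^ ((-1 : ℝ) - 1)) • g (b ^ (-1 : ℝ)) =
      b ^ (-γ / 2 - 1) * Real.exp (-(r ^ 2 / b)) := by
    intro b (hb : 0 < b)
    simp only [g, smul_eq_mul, abs_neg, abs_one, one_mul]
    rw [← Real.rpow_mul hb.le, ← mul_assoc, ← Real.rpow_add hb, Real.rpow_neg_one, div_eq_mul_inv]
    congr 2
    ring
  simp only [subordinationKernel]
  rw [integral_const_mul, ← setIntegral_congr_fun measurableSet_Ioi hinv,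
    integral_comp_rpow_Ioi g (by norm_num), hg, Real.mul_rpow zero_le_two hr.le,
    Real.rpow_neg hr.le]
  have := (Real.rpow_pos_of_pos hr γ).ne'
  field_simp

lemma integrableOn_subordinationKernel (hγ : 0 < γ) {r : ℝ} (hr : 0 < r) :
    IntegrableOn (fun b => subordinationKernel γ b r) (Set.Ioi 0) := by
  refine Integrable.of_integral_ne_zero ?_
  rw [integral_subordinationKernel hγ hr]
  exact (mul_pos (by positivity) (Real.Gamma_pos_of_pos (by positivity))).ne'

lemma lintegral_rpow_mul_exp_neg_mul {a r : ℝ} (ha : 0 < a) (hr : 0 < r) :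
    ∫⁻ b in Set.Ioi (0 : ℝ), ENNReal.ofReal (b ^ (a - 1) * Real.exp (-(r * b))) =
      ENNReal.ofReal (r ^ (-a) * Real.Gamma a) := by
  have hval : ∫ b in Set.Ioi (0 : ℝ), b ^ (a - 1) * Real.exp (-(r * b)) =
      r ^ (-a) * Real.Gamma a := by
    rw [Real.integral_rpow_mul_exp_neg_mul_Ioi ha hr, one_div, Real.inv_rpow hr.le,
      Real.rpow_neg hr.le]
  have hpos := mul_pos (Real.rpow_pos_of_pos hr (-a)) (Real.Gamma_pos_of_pos ha)
  rw [← hval, ofReal_integral_eq_lintegral_ofReal]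
  · exact Integrable.of_integral_ne_zero (hval ▸ hpos.ne')
  · filter_upwards [ae_restrict_mem measurableSet_Ioi] with b (hb : 0 < b)
    positivity

variable {V : Type*} [NormedAddCommGroup V] [NormedSpace ℝ V]

/-- The inverse Fourier transform of `ξ ↦ b^(-γ/2-1) exp(-(π|ξ|)²/b)`, the Gaussian factor of
`subordinationKernel γ b (π|ξ|)`. -/
def subordinationGaussian (γ b : ℝ) (y : V) : ℝ :=
  b ^ (-γ / 2 - 1) *
    ((b / Real.pi) ^ ((Module.finrank ℝ V : ℝ) / 2) * Real.exp (-(b * ‖y‖ ^ 2)))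

lemma lintegral_subordinationGaussian (hγ : γ < Module.finrank ℝ V) {y : V}
    (hy : y ≠ 0) :
    ∫⁻ b in Set.Ioi (0 : ℝ), ENNReal.ofReal (subordinationGaussian γ b y) =
      ENNReal.ofReal (Real.pi ^ (-(Module.finrank ℝ V : ℝ) / 2) *
        Real.Gamma (((Module.finrank ℝ V : ℝ) - γ) / 2)) *
        ‖y‖ₑ ^ (-(Module.finrank ℝ V - γ)) := by
  set d : ℝ := (Module.finrank ℝ V : ℝ) with hd
  have hy0 : 0 < ‖y‖ := norm_pos_iff.2 hy
  have hsplit : ∀ b ∈ Set.Ioi (0 : ℝ), ENNReal.ofReal (subordinationGaussian γ b y) =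
      ENNReal.ofReal (Real.pi ^ (-d / 2)) *
        ENNReal.ofReal (b ^ ((d - γ) / 2 - 1) * Real.exp (-(‖y‖ ^ 2 * b))) := by
    intro b (hb : 0 < b)
    have hexp : (d - γ) / 2 - 1 = -γ / 2 - 1 + d / 2 := by ring
    rw [subordinationGaussian, ← hd, ← ENNReal.ofReal_mul (by positivity),
      Real.div_rpow hb.le Real.pi_pos.le, hexp, Real.rpow_add hb, neg_div _ d,
      Real.rpow_neg Real.pi_pos.le]
    ring_nf
  have hpow : (‖y‖ ^ 2) ^ (-((d - γ) / 2)) = ‖y‖ ^ (-(d - γ)) := by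
    rw [← Real.rpow_natCast, ← Real.rpow_mul hy0.le]
    congr 1
    push_cast
    ring
  rw [setLIntegral_congr_fun measurableSet_Ioi hsplit, lintegral_const_mul' _ _ (by simp),
    lintegral_rpow_mul_exp_neg_mul (by linarith) (by positivity), hpow, ← ofReal_norm y,
    ENNReal.ofReal_rpow_of_pos hy0, ← ENNReal.ofReal_mul (by positivity),
    ← ENNReal.ofReal_mul (mul_pos (by positivity) (Real.Gamma_pos_of_pos (by linarith))).le]
  ring_nf

variable [MeasurableSpace V] [BorelSpace V]

lemma measurable_subordinationGaussian (γ : ℝ) :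
    Measurable fun z : ℝ × V => ENNReal.ofReal (subordinationGaussian γ z.1 z.2) := by
  unfold subordinationGaussian
  fun_prop

variable [FiniteDimensional ℝ V] [Nontrivial V] (μ : Measure V) [μ.IsAddHaarMeasure]
  {F : Type*} [NormedAddCommGroup F] [NormedSpace ℝ F] {g : V → F}

lemma integrable_subordinationKernel_smul (hγ : 0 < γ) (hg : Integrable g μ) :
    Integrable (Function.uncurry fun (b : ℝ) (ξ : V) =>
      subordinationKernel γ b (Real.pi * ‖ξ‖) • g ξ) ((volume.restrict (Set.Ioi 0)).prod μ) := by
  have hmeas : Measurable fun z : ℝ × V => subordinationKernel γ z.1 (Real.pi * ‖z.2‖) := by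
    unfold subordinationKernel
    fun_prop
  have hpos : ∀ ξ : V, ξ ≠ 0 → 0 < Real.pi * ‖ξ‖ := fun ξ hξ => by positivity
  refine (integrable_prod_iff' (hmeas.aestronglyMeasurable.smul hg.1.comp_snd)).2 ⟨?_, ?_⟩
  · filter_upwards [Measure.ae_ne μ (0 : V)] with ξ hξ
    exact (integrableOn_subordinationKernel hγ (hpos ξ hξ)).smul_const (g ξ)
  · refine (hg.norm.const_mul (2 ^ γ * Real.Gamma (γ / 2))).congr ?_
    filter_upwards [Measure.ae_ne μ (0 : V)] with ξ hξ
    rw [← integral_subordinationKernel hγ (hpos ξ hξ), ← integral_mul_const]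
    refine setIntegral_congr_fun measurableSet_Ioi fun b (hb : 0 < b) => ?_
    rw [Pi.smul_apply', norm_smul,
      Real.norm_of_nonneg (subordinationKernel_nonneg hb.le (by positivity))]

lemma integral_integral_subordinationKernel_smul [CompleteSpace F] (hγ : 0 < γ)
    (hg : Integrable g μ) :
    ∫ b in Set.Ioi (0 : ℝ), (∫ ξ, subordinationKernel γ b (Real.pi * ‖ξ‖) • g ξ ∂μ) =
      (2 ^ γ * Real.Gamma (γ / 2)) • ∫ ξ, g ξ ∂μ := by
  rw [integral_integral_swap (integrable_subordinationKernel_smul μ hγ hg), ← integral_smul]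
  refine integral_congr_ae ?_
  filter_upwards [Measure.ae_ne μ (0 : V)] with ξ hξ
  rw [integral_smul_const, integral_subordinationKernel hγ (by positivity)]

end Subordination

section RieszRepresentation

variable {V : Type*} [NormedAddCommGroup V] [InnerProductSpace ℝ V] [FiniteDimensional ℝ V]
  [MeasurableSpace V] [BorelSpace V]

lemma continuous_fourierInv {h : V → ℂ} (hh : Integrable h) : Continuous (𝓕⁻ h) :=
  VectorFourier.fourierIntegral_continuous (μ := volume) (L := -innerₗ V)
    Real.continuous_fourierChar (continuous_inner.neg) hh

lemma integrable_fourierChar_smul {h : V → ℂ} (hh : Integrable h) (x : V) :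
    Integrable fun ξ => 𝐞 (inner ℝ ξ x) • h ξ := by
  simpa using (Real.fourierIntegral_convergent_iff (-x)).2 hh

lemma fourier_fourierChar_smul (h : V → ℂ) (x y : V) :
    𝓕 (fun ξ => 𝐞 (inner ℝ ξ x) • h ξ) y = 𝓕⁻ h (x - y) := by
  rw [Real.fourier_eq, Real.fourierInv_eq]
  refine integral_congr_ae (.of_forall fun ξ => ?_)
  simp only
  rw [smul_smul, ← AddChar.map_add_eq_mul, inner_sub_right, neg_add_eq_sub]

lemma integrable_gaussian {b : ℝ} (hb : 0 < b) :
    Integrable fun y : V => (Real.exp (-(b * ‖y‖ ^ 2)) : ℂ) := by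
  simpa using GaussianFourier.integrable_cexp_neg_mul_sq_norm_add (b := b) (by simpa) 0 (0 : V)

lemma fourier_gaussian {b : ℝ} (hb : 0 < b) (ξ : V) :
    𝓕 (fun y : V => (Real.exp (-(b * ‖y‖ ^ 2)) : ℂ)) ξ =
      (((Real.pi / b) ^ ((Module.finrank ℝ V : ℝ) / 2) : ℝ) : ℂ) *
        (Real.exp (-((Real.pi * ‖ξ‖) ^ 2 / b)) : ℂ) := by
  have h := fourier_gaussian_innerProductSpace (b := b) (by simpa) ξ
  rw [Complex.ofReal_cpow (by positivity)]
  push_cast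
  simp only [neg_mul] at h
  rw [h]
  congr 2
  ring

lemma integral_gaussian_mul_eq {h : V → ℂ} (hh : Integrable h) {b : ℝ} (hb : 0 < b) (x : V) :
    ∫ ξ, (Real.exp (-((Real.pi * ‖ξ‖) ^ 2 / b)) : ℂ) * (𝐞 (inner ℝ ξ x) • h ξ) =
      (((b / Real.pi) ^ ((Module.finrank ℝ V : ℝ) / 2) : ℝ) : ℂ) *
        ∫ y, (Real.exp (-(b * ‖y‖ ^ 2)) : ℂ) * 𝓕⁻ h (x - y) := by
  set H : V → ℂ := fun ξ => 𝐞 (inner ℝ ξ x) • h ξ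
  set P : V → ℂ := fun y => (Real.exp (-(b * ‖y‖ ^ 2)) : ℂ)
  have hflip : ∫ y, 𝓕 H y * P y = ∫ ξ, H ξ * 𝓕 P ξ := by
    have := VectorFourier.integral_fourierIntegral_smul_eq_flip (L := innerₗ V)
      Real.continuous_fourierChar continuous_inner (integrable_fourierChar_smul hh x)
      (integrable_gaussian hb)
    rwa [flip_innerₗ] at this
  have hconst : (b / Real.pi) ^ ((Module.finrank ℝ V : ℝ) / 2) *
      (Real.pi / b) ^ ((Module.finrank ℝ V : ℝ) / 2) = 1 := by
    rw [← Real.mul_rpow (by positivity) (by positivity), div_mul_div_cancel₀ Real.pi_ne_zero,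
      div_self hb.ne', Real.one_rpow]
  have hP : ∀ ξ, (((b / Real.pi) ^ ((Module.finrank ℝ V : ℝ) / 2) : ℝ) : ℂ) * 𝓕 P ξ =
      (Real.exp (-((Real.pi * ‖ξ‖) ^ 2 / b)) : ℂ) := fun ξ => by
    rw [fourier_gaussian hb, ← mul_assoc, ← Complex.ofReal_mul, hconst, Complex.ofReal_one,
      one_mul]
  calc ∫ ξ, (Real.exp (-((Real.pi * ‖ξ‖) ^ 2 / b)) : ℂ) * H ξ
      = (((b / Real.pi) ^ ((Module.finrank ℝ V : ℝ) / 2) : ℝ) : ℂ) * ∫ ξ, H ξ * 𝓕 P ξ := by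
        simp_rw [← integral_const_mul, ← hP, mul_comm (H _), mul_assoc]
    _ = _ := by simp_rw [← hflip, H, fourier_fourierChar_smul, mul_comm (𝓕⁻ h _), P]

lemma integrable_gaussian_mul_fourierInv {h : V → ℂ} (hh : Integrable h) {b : ℝ} (hb : 0 < b)
    (x : V) : Integrable fun y => (Real.exp (-(b * ‖y‖ ^ 2)) : ℂ) * 𝓕⁻ h (x - y) := by
  have hcont := continuous_fourierInv hh
  refine (integrable_gaussian hb).mul_bdd (c := ∫ ξ, ‖h ξ‖) (by fun_prop) (.of_forall fun y => ?_)
  exact VectorFourier.norm_fourierIntegral_le_integral_norm _ _ _ _ _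

lemma enorm_re_integral_gaussian_mul_le {h : V → ℂ} (hh : Integrable h) {b : ℝ} (hb : 0 < b)
    (x : V) :
    ‖(∫ ξ, (Real.exp (-((Real.pi * ‖ξ‖) ^ 2 / b)) : ℂ) * (𝐞 (inner ℝ ξ x) • h ξ)).re‖ₑ ≤
      ∫⁻ y, ENNReal.ofReal ((b / Real.pi) ^ ((Module.finrank ℝ V : ℝ) / 2) *
        Real.exp (-(b * ‖y‖ ^ 2))) * ‖(𝓕⁻ h (x - y)).re‖ₑ := by
  have hre : (∫ y, (Real.exp (-(b * ‖y‖ ^ 2)) : ℂ) * 𝓕⁻ h (x - y)).re =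
      ∫ y, Real.exp (-(b * ‖y‖ ^ 2)) * (𝓕⁻ h (x - y)).re := by
    simp_rw [← Complex.re_ofReal_mul]
    exact (integral_re (integrable_gaussian_mul_fourierInv hh hb x)).symm
  rw [integral_gaussian_mul_eq hh hb, Complex.re_ofReal_mul, hre, ← integral_const_mul]
  refine (enorm_integral_le_lintegral_enorm _).trans_eq (lintegral_congr fun y => ?_)
  rw [← mul_assoc, enorm_mul, Real.enorm_of_nonneg (by positivity)]

/-- The operator `(-Δ)^{γ/2}` on the Fourier side: multiplication by its symbol `(2π|ξ|)^γ`. -/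
def fracMultiplier (γ : ℝ) (ψ : V → ℂ) (ξ : V) : ℂ :=
  (((2 * Real.pi * ‖ξ‖) ^ γ : ℝ) : ℂ) * ψ ξ

variable {γ : ℝ} {ψ : V → ℂ}

lemma ofReal_mul_enorm_re_fourierInv_le [Nontrivial V] (hγ : 0 < γ) (hψ : Integrable ψ) (x : V) :
    ENNReal.ofReal (2 ^ γ * Real.Gamma (γ / 2)) * ‖(𝓕⁻ ψ x).re‖ₑ ≤
      ∫⁻ b in Set.Ioi (0 : ℝ),
        ‖(∫ ξ, subordinationKernel γ b (Real.pi * ‖ξ‖) • (𝐞 (inner ℝ ξ x) • ψ ξ)).re‖ₑ := by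
  have hΦ := integrable_fourierChar_smul hψ x
  have hpos : 0 < 2 ^ γ * Real.Gamma (γ / 2) :=
    mul_pos (by positivity) (Real.Gamma_pos_of_pos (by positivity))
  rw [← Real.enorm_of_nonneg hpos.le, ← enorm_mul, ← smul_eq_mul, ← Complex.smul_re,
    Real.fourierInv_eq, ← integral_integral_subordinationKernel_smul volume hγ hΦ]
  have hre := integral_re (integrable_subordinationKernel_smul volume hγ hΦ).integral_prod_left
  exact (congrArg enorm hre).ge.trans (enorm_integral_le_lintegral_enorm _)

lemma enorm_re_integral_subordinationKernel_smul_le (hψ : Integrable (fracMultiplier γ ψ)) {b : ℝ}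
    (hb : 0 < b) (x : V) :
    ‖(∫ ξ, subordinationKernel γ b (Real.pi * ‖ξ‖) • (𝐞 (inner ℝ ξ x) • ψ ξ)).re‖ₑ ≤
      ∫⁻ y, ENNReal.ofReal (subordinationGaussian γ b y) *
        ‖(𝓕⁻ (fracMultiplier γ ψ) (x - y)).re‖ₑ := by
  have hgauss : ∫ ξ, subordinationKernel γ b (Real.pi * ‖ξ‖) • (𝐞 (inner ℝ ξ x) • ψ ξ) =
      ((b ^ (-γ / 2 - 1) : ℝ) : ℂ) * ∫ ξ, (Real.exp (-((Real.pi * ‖ξ‖) ^ 2 / b)) : ℂ) *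
        (𝐞 (inner ℝ ξ x) • fracMultiplier γ ψ ξ) := by
    rw [← integral_const_mul]
    refine integral_congr_ae (.of_forall fun ξ => ?_)
    simp only [subordinationKernel, fracMultiplier, Circle.smul_def, smul_eq_mul,
      Complex.real_smul, mul_assoc, Complex.ofReal_mul]
    ring
  rw [hgauss, Complex.re_ofReal_mul, enorm_mul, Real.enorm_of_nonneg (by positivity)]
  refine (mul_le_mul_right (enorm_re_integral_gaussian_mul_le hψ hb x) _).trans_eq ?_
  rw [← lintegral_const_mul' _ _ (by simp)]
  simp_rw [← mul_assoc, ← ENNReal.ofReal_mul (Real.rpow_nonneg hb.le _), subordinationGaussian]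

theorem exists_enorm_fourierInv_le_rieszPotential (hγ : 0 < γ) (hγ' : γ < Module.finrank ℝ V) :
    ∃ C : ℝ≥0∞, C ≠ ⊤ ∧ ∀ ψ : V → ℂ, Integrable ψ → Integrable (fracMultiplier γ ψ) → ∀ x,
      ‖(𝓕⁻ ψ x).re‖ₑ ≤ C * rieszPotential volume (Module.finrank ℝ V - γ)
        (fun y => ‖(𝓕⁻ (fracMultiplier γ ψ) y).re‖ₑ) x := by
  have : Nontrivial V := Module.nontrivial_of_finrank_pos (R := ℝ) (mod_cast hγ.trans hγ')
  set d : ℝ := (Module.finrank ℝ V : ℝ)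
  set c₀ : ℝ := 2 ^ γ * Real.Gamma (γ / 2)
  set c₁ : ℝ := Real.pi ^ (-d / 2) * Real.Gamma ((d - γ) / 2)
  have hc₀ : 0 < c₀ := mul_pos (by positivity) (Real.Gamma_pos_of_pos (by positivity))
  have hc₀' : ENNReal.ofReal c₀ ≠ 0 := by simpa using hc₀
  refine ⟨(ENNReal.ofReal c₀)⁻¹ * ENNReal.ofReal c₁, by finiteness, fun ψ hψ hh x => ?_⟩
  set f : V → ℝ≥0∞ := fun y => ‖(𝓕⁻ (fracMultiplier γ ψ) y).re‖ₑ
  have hf : Measurable f := (Complex.continuous_re.comp (continuous_fourierInv hh)).enorm.measurable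
  rw [mul_assoc, ← ENNReal.mul_le_iff_le_inv hc₀' (by simp)]
  calc ENNReal.ofReal c₀ * ‖(𝓕⁻ ψ x).re‖ₑ
      ≤ ∫⁻ b in Set.Ioi (0 : ℝ),
          ‖(∫ ξ, subordinationKernel γ b (Real.pi * ‖ξ‖) • (𝐞 (inner ℝ ξ x) • ψ ξ)).re‖ₑ :=
        ofReal_mul_enorm_re_fourierInv_le hγ hψ x
    _ ≤ ∫⁻ b in Set.Ioi (0 : ℝ),
          ∫⁻ y, ENNReal.ofReal (subordinationGaussian γ b y) * f (x - y) :=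
        setLIntegral_mono' measurableSet_Ioi fun b hb =>
          enorm_re_integral_subordinationKernel_smul_le hh hb x
    _ = ∫⁻ y, (∫⁻ b in Set.Ioi (0 : ℝ), ENNReal.ofReal (subordinationGaussian γ b y)) *
          f (x - y) := by
        rw [lintegral_lintegral_swap ((measurable_subordinationGaussian γ).mul
          (hf.comp (measurable_snd.const_sub x))).aemeasurable]
        exact lintegral_congr fun y => lintegral_mul_const' _ _ (by simp [f])
    _ = ∫⁻ y, ENNReal.ofReal c₁ * (‖y‖ₑ ^ (-(d - γ)) * f (x - y)) := by
        refine lintegral_congr_ae ?_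
        filter_upwards [Measure.ae_ne volume (0 : V)] with y hy
        rw [lintegral_subordinationGaussian hγ' hy, mul_assoc]
    _ = ENNReal.ofReal c₁ * rieszPotential volume (d - γ) f x := by
        rw [lintegral_const_mul' _ _ (by simp), ← lintegral_sub_left_eq_self _ x]
        simp_rw [sub_sub_cancel, rieszPotential]

end RieszRepresentation

section Completion

lemma exists_tendsto_eLpNorm_of_cauchy {X F : Type*} [MeasurableSpace X] {μ : Measure X}
    [NormedAddCommGroup F] [CompleteSpace F] {p : ℝ≥0∞} (hp : 1 ≤ p) {g : ℕ → X → F}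
    (hg : ∀ k, AEStronglyMeasurable (g k) μ)
    (hc : Tendsto (fun jk : ℕ × ℕ => eLpNorm (g jk.1 - g jk.2) p μ) atTop (𝓝 0)) :
    ∃ f : X → F, AEStronglyMeasurable f μ ∧
      Tendsto (fun k => eLpNorm (g k - f) p μ) atTop (𝓝 0) := by
  have : Fact (1 ≤ p) := ⟨hp⟩
  obtain ⟨⟨K₁, K₂⟩, hK⟩ := eventually_atTop.1 ((tendsto_order.1 hc).2 1 one_pos)
  set K := max K₁ K₂
  have hmem : ∀ k, MemLp (g (k + K) - g K) p μ := fun k =>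
    ⟨(hg _).sub (hg _), (hK (k + K, K) ⟨(le_max_left K₁ K₂).trans (Nat.le_add_left _ _),
      le_max_right K₁ K₂⟩).trans ENNReal.one_lt_top⟩
  have hcauchy : CauchySeq fun k => (hmem k).toLp := by
    rw [Lp.cauchySeq_Lp_iff_cauchySeq_eLpNorm]
    have hs : Tendsto (fun jk : ℕ × ℕ => (jk.1 + K, jk.2 + K)) atTop atTop := by
      rw [← prod_atTop_atTop_eq]
      exact (tendsto_add_atTop_nat K).prodMap (tendsto_add_atTop_nat K)
    refine (hc.comp hs).congr fun jk => ?_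
    refine eLpNorm_congr_ae ?_
    filter_upwards [(hmem jk.1).coeFn_toLp, (hmem jk.2).coeFn_toLp] with x h₁ h₂
    simp [h₁, h₂]
  obtain ⟨G, hG⟩ := cauchySeq_tendsto_of_complete hcauchy
  rw [Lp.tendsto_Lp_iff_tendsto_eLpNorm'] at hG
  refine ⟨g K + G, (hg K).add (Lp.aestronglyMeasurable G), ?_⟩
  rw [← tendsto_add_atTop_iff_nat K]
  refine hG.congr fun k => eLpNorm_congr_ae ?_
  filter_upwards [(hmem k).coeFn_toLp] with x h₁
  simp [h₁, sub_sub]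

variable {n m : ℕ}

lemma measurable_weight (a : ℝ) : Measurable (weight a : Space n m → ℝ) :=
  measurable_hat.norm.pow_const a

lemma weight_ne_zero {X : Space n m} (hX : hat X ≠ 0) (a : ℝ) : weight a X ≠ 0 :=
  (Real.rpow_pos_of_pos (norm_pos_iff.2 hX) a).ne'

lemma enorm_weight {X : Space n m} (hX : hat X ≠ 0) (a : ℝ) : ‖weight a X‖ₑ = ‖hat X‖ₑ ^ a := by
  rw [weight, Real.enorm_of_nonneg (by positivity),
    ← ENNReal.ofReal_rpow_of_pos (norm_pos_iff.2 hX), ofReal_norm]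

variable {F : Type*} [NormedAddCommGroup F] [NormedSpace ℝ F]

lemma eLpNorm_weight_smul (hm : 0 < m) {p : ℝ} (hp : 0 < p) (a : ℝ) (f : Space n m → F) :
    eLpNorm (fun X => weight a X • f X) (ENNReal.ofReal p) volume =
      eLpNorm' (fun X => ‖hat X‖ₑ ^ a * ‖f X‖ₑ) p volume := by
  rw [eLpNorm_eq_eLpNorm' (by simpa using hp) ENNReal.ofReal_ne_top, ENNReal.toReal_ofReal hp.le]
  refine eLpNorm'_congr_enorm_ae ?_
  filter_upwards [ae_hat_ne_zero hm] with X hX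
  rw [enorm_smul, enorm_weight hX, enorm_eq_self]

lemma eLpNorm_weight_smul_le_of_le_rieszPotential (hm : 0 < m) {p q α β s : ℝ} (hp : 0 < p)
    (hq : 0 < q) {C₀ C : ℝ≥0∞} (hC₀ : C₀ ≠ ⊤)
    (hC : ∀ G : Space n m → ℝ≥0∞, Measurable G →
      eLpNorm' (fun X => ‖hat X‖ₑ ^ (-β) * rieszPotential volume s G X) q volume ≤
        C * eLpNorm' (fun Y => ‖hat Y‖ₑ ^ α * G Y) p volume)
    {φ : Space n m → ℝ} {f : Space n m → F} (hf : Continuous f)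
    (h : ∀ X, ‖φ X‖ₑ ≤ C₀ * rieszPotential volume s (fun Y => ‖f Y‖ₑ) X) :
    eLpNorm (fun X => weight (-β) X • φ X) (ENNReal.ofReal q) volume ≤
      C₀ * C * eLpNorm (fun X => weight α X • f X) (ENNReal.ofReal p) volume := by
  rw [eLpNorm_weight_smul hm hp, eLpNorm_weight_smul hm hq, mul_assoc]
  refine le_trans ?_ (mul_le_mul_right (hC _ hf.enorm.measurable) C₀)
  rw [← eLpNorm'_const_mul_of_ne_top hq hC₀]
  refine eLpNorm'_mono_enorm_ae hq.le (.of_forall fun X => ?_)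
  rw [enorm_eq_self, enorm_eq_self, mul_left_comm]
  exact mul_le_mul_right (h X) _

lemma aestronglyMeasurable_weight_smul (a : ℝ) {f : Space n m → F}
    (hf : AEStronglyMeasurable f volume) :
    AEStronglyMeasurable (fun X => weight a X • f X) volume :=
  (measurable_weight a).aestronglyMeasurable.smul hf

lemma wdist_eq (a p : ℝ) (f g : Space n m → F) :
    wdist a p f g = eLpNorm ((fun X => weight a X • f X) - fun X => weight a X • g X)
      (ENNReal.ofReal p) volume := by
  rw [wdist]
  congr 1
  ext X
  simp [smul_sub]

lemma exists_tendsto_wdist_of_cauchy [CompleteSpace F] (hm : 0 < m) {a p : ℝ} (hp : 1 ≤ p)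
    {f : ℕ → Space n m → F} (hf : ∀ k, AEStronglyMeasurable (f k) volume)
    (hc : Tendsto (fun jk : ℕ × ℕ => wdist a p (f jk.1) (f jk.2)) atTop (𝓝 0)) :
    ∃ g : Space n m → F, AEStronglyMeasurable g volume ∧
      Tendsto (fun k => wdist a p (f k) g) atTop (𝓝 0) := by
  simp only [wdist_eq] at hc
  obtain ⟨G, hG, hlim⟩ := exists_tendsto_eLpNorm_of_cauchy
    (ENNReal.one_le_ofReal.2 hp)
    (fun k => aestronglyMeasurable_weight_smul a (hf k)) hc
  refine ⟨fun X => (weight a X)⁻¹ • G X,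
    (measurable_weight a).inv.aestronglyMeasurable.smul hG, ?_⟩
  refine hlim.congr fun k => ?_
  rw [wdist_eq]
  refine eLpNorm_congr_ae ?_
  filter_upwards [ae_hat_ne_zero hm] with X hX
  simp [smul_inv_smul₀ (weight_ne_zero hX a)]

lemma exists_seq_tendsto_ae_of_wdist (hm : 0 < m) {a p : ℝ} (hp : 0 < p)
    {f : ℕ → Space n m → F} {g : Space n m → F} (hf : ∀ k, AEStronglyMeasurable (f k) volume)
    (hg : AEStronglyMeasurable g volume) (h : Tendsto (fun k => wdist a p (f k) g) atTop (𝓝 0)) :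
    ∃ ns : ℕ → ℕ, StrictMono ns ∧ ∀ᵐ X, Tendsto (fun k => f (ns k) X) atTop (𝓝 (g X)) := by
  simp only [wdist_eq] at h
  obtain ⟨ns, hns, hlim⟩ := (tendstoInMeasure_of_tendsto_eLpNorm (by simpa using hp)
    (fun k => aestronglyMeasurable_weight_smul a (hf k))
    (aestronglyMeasurable_weight_smul a hg) h).exists_seq_tendsto_ae
  refine ⟨ns, hns, ?_⟩
  filter_upwards [hlim, ae_hat_ne_zero hm] with X hX hX₀
  have := hX.const_smul (weight a X)⁻¹
  simpa only [inv_smul_smul₀ (weight_ne_zero hX₀ a)] using this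

variable {D : (Space n m → ℝ) → Space n m → F} {α β p q : ℝ} {C : ℝ≥0∞}

lemma InCompletion.eLpNorm_le (hp : 1 ≤ p) (hC : C ≠ ⊤)
    (hD : ∀ φ, IsTest φ → Continuous (D φ))
    (hle : ∀ φ, IsTest φ → eLpNorm (fun X => weight (-β) X • φ X) (ENNReal.ofReal q) volume ≤
      C * eLpNorm (fun X => weight α X • D φ X) (ENNReal.ofReal p) volume)
    {u : Space n m → ℝ} {f : Space n m → F} (h : InCompletion D α p u f) :
    eLpNorm (fun X => weight (-β) X • u X) (ENNReal.ofReal q) volume ≤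
      C * eLpNorm (fun X => weight α X • f X) (ENNReal.ofReal p) volume := by
  obtain ⟨hf, φ, hφ, hu, hlim⟩ := h
  set A := eLpNorm (fun X => weight α X • f X) (ENNReal.ofReal p) volume
  have hbound : ∀ k, eLpNorm (fun X => weight (-β) X • φ k X) (ENNReal.ofReal q) volume ≤
      C * (wdist α p (D (φ k)) f + A) := fun k => by
    refine (hle _ (hφ k)).trans (mul_le_mul_right ?_ C)
    have hm₁ := aestronglyMeasurable_weight_smul α (hD _ (hφ k)).aestronglyMeasurable
    have hm₂ := aestronglyMeasurable_weight_smul α hf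
    rw [wdist_eq]
    refine le_trans (le_of_eq ?_) (eLpNorm_add_le (hm₁.sub hm₂) hm₂ (ENNReal.one_le_ofReal.2 hp))
    rw [sub_add_cancel]
  have hC' : Tendsto (fun k => C * (wdist α p (D (φ k)) f + A)) atTop (𝓝 (C * A)) := by
    have := ENNReal.Tendsto.const_mul (hlim.add_const A) (Or.inr hC)
    rwa [zero_add] at this
  refine (Lp.eLpNorm_lim_le_liminf_eLpNorm (f := fun k X => weight (-β) X • φ k X) (fun k =>
    aestronglyMeasurable_weight_smul (-β) (hφ k).1.continuous.aestronglyMeasurable) _ ?_).trans ?_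
  · filter_upwards [hu] with X hX
    exact hX.const_smul _
  · rw [← hC'.liminf_eq]
    exact liminf_le_liminf (.of_forall hbound)

lemma IsTest.sub {φ ψ : Space n m → ℝ} (hφ : IsTest φ) (hψ : IsTest ψ) : IsTest (φ - ψ) :=
  ⟨hφ.1.sub hψ.1, hφ.2.sub hψ.2⟩

lemma IsCauchySeq.exists_inCompletion [CompleteSpace F] (hm : 0 < m) (hp : 1 ≤ p) (hq : 1 ≤ q)
    (hC : C ≠ ⊤) (hD : ∀ φ, IsTest φ → Continuous (D φ))
    (hsub : ∀ φ ψ, IsTest φ → IsTest ψ → D (φ - ψ) = D φ - D ψ)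
    (hle : ∀ φ, IsTest φ → eLpNorm (fun X => weight (-β) X • φ X) (ENNReal.ofReal q) volume ≤
      C * eLpNorm (fun X => weight α X • D φ X) (ENNReal.ofReal p) volume)
    {φ : ℕ → Space n m → ℝ} (h : IsCauchySeq D α p φ) :
    ∃ (u : Space n m → ℝ) (f : Space n m → F), InCompletion D α p u f ∧
      Tendsto (fun k => wdist α p (D (φ k)) f) atTop (𝓝 0) ∧
      Tendsto (fun k => wdist (-β) q (φ k) u) atTop (𝓝 0) := by
  obtain ⟨hφ, hc⟩ := h
  have hφm : ∀ k, AEStronglyMeasurable (φ k) volume := fun k =>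
    (hφ k).1.continuous.aestronglyMeasurable
  have hDm : ∀ k, AEStronglyMeasurable (D (φ k)) volume := fun k =>
    (hD _ (hφ k)).aestronglyMeasurable
  have hc' : Tendsto (fun jk : ℕ × ℕ => wdist (-β) q (φ jk.1) (φ jk.2)) atTop (𝓝 0) := by
    have hlim := ENNReal.Tendsto.const_mul hc (Or.inr hC)
    rw [mul_zero] at hlim
    refine tendsto_of_tendsto_of_tendsto_of_le_of_le tendsto_const_nhds hlim (fun _ => zero_le)
      fun jk => ?_
    have := hle _ ((hφ jk.1).sub (hφ jk.2))
    rwa [hsub _ _ (hφ _) (hφ _)] at this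
  obtain ⟨f, hf, hflim⟩ := exists_tendsto_wdist_of_cauchy hm hp hDm hc
  obtain ⟨u, hu, hulim⟩ := exists_tendsto_wdist_of_cauchy hm hq hφm hc'
  obtain ⟨ns, hns, hae⟩ := exists_seq_tendsto_ae_of_wdist hm (by linarith) hφm hu hulim
  exact ⟨u, f, ⟨hf, fun k => φ (ns k), fun k => hφ _, hae, hflim.comp hns.tendsto_atTop⟩,
    hflim, hulim⟩

theorem exists_sobolev_constant [CompleteSpace F] (hm : 0 < m) (hp : 1 < p) (hpq : p ≤ q)
    (hαβ : 0 ≤ α + β) (hα : α < m / Real.conjExponent p) (hβ : β < m / q)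
    {γ : ℝ} (hγ : 0 < γ) (hγ' : γ < n + m)
    (hdeg : 1 / q = 1 / p + (α + β - γ) / (n + m))
    (hD : ∀ φ, IsTest φ → Continuous (D φ))
    (hsub : ∀ φ ψ, IsTest φ → IsTest ψ → D (φ - ψ) = D φ - D ψ) (hC : C ≠ ⊤)
    (hpot : ∀ φ, IsTest φ → ∀ X,
      ‖φ X‖ₑ ≤ C * rieszPotential volume (n + m - γ) (fun Y => ‖D φ Y‖ₑ) X) :
    ∃ S : ℝ, 0 < S ∧
      (∀ (u : Space n m → ℝ) (f : Space n m → F), InCompletion D α p u f →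
        eLpNorm (fun X => weight (-β) X * u X) (ENNReal.ofReal q) volume ≤
          ENNReal.ofReal S * eLpNorm (fun X => weight α X • f X) (ENNReal.ofReal p) volume) ∧
      ∀ φ : ℕ → Space n m → ℝ, IsCauchySeq D α p φ →
        ∃ (u : Space n m → ℝ) (f : Space n m → F), InCompletion D α p u f ∧
          Tendsto (fun k => wdist α p (D (φ k)) f) atTop (𝓝 0) ∧
          Tendsto (fun k => wdist (-β) q (φ k) u) atTop (𝓝 0) := by
  obtain ⟨C', hC', hSW⟩ := exists_stein_weiss_hat hp hpq hm hαβ hα hβ hγ hγ' hdeg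
  have hCC : C * C' ≠ ⊤ := ENNReal.mul_ne_top hC hC'
  have hle : ∀ φ, IsTest φ → eLpNorm (fun X => weight (-β) X • φ X) (ENNReal.ofReal q) volume ≤
      C * C' * eLpNorm (fun X => weight α X • D φ X) (ENNReal.ofReal p) volume := fun φ hφ =>
    eLpNorm_weight_smul_le_of_le_rieszPotential hm (by linarith) (by linarith) hC hSW
      (hD φ hφ) (hpot φ hφ)
  refine ⟨(C * C').toReal + 1, by positivity, fun u f h => ?_, fun φ h =>
    h.exists_inCompletion hm hp.le (hp.le.trans hpq) hCC hD hsub hle⟩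
  refine (h.eLpNorm_le hp.le hCC hD hle).trans (mul_le_mul_left ?_ _)
  exact (ENNReal.ofReal_toReal hCC).ge.trans (ENNReal.ofReal_le_ofReal (by linarith))

end Completion

section Operators

section FourierMultiplier

variable {V : Type*} [NormedAddCommGroup V]

lemma fracMultiplier_sub (γ : ℝ) (f g : V → ℂ) :
    fracMultiplier γ (f - g) = fracMultiplier γ f - fracMultiplier γ g := by
  ext ξ
  simp only [fracMultiplier, Pi.sub_apply, mul_sub]

variable [InnerProductSpace ℝ V] [FiniteDimensional ℝ V] [MeasurableSpace V] [BorelSpace V]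

lemma integrable_fracMultiplier {γ : ℝ} (hγ : 0 < γ) (f : SchwartzMap V ℂ) :
    Integrable (fracMultiplier γ f) := by
  have hsymbol : Continuous fun ξ : V => (2 * Real.pi * ‖ξ‖) ^ γ :=
    (by fun_prop : Continuous fun ξ : V => 2 * Real.pi * ‖ξ‖).rpow_const fun _ => .inr hγ.le
  have hcont : Continuous (fracMultiplier γ f) :=
    (Complex.continuous_ofReal.comp hsymbol).mul f.continuous
  have hdom : Integrable fun ξ : V => (2 * Real.pi) ^ γ * (‖f ξ‖ + ‖ξ‖ ^ ⌈γ⌉₊ * ‖f ξ‖) :=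
    (f.integrable.norm.add (f.integrable_pow_mul volume _)).const_mul _
  have hpow : ∀ ξ : V, ‖ξ‖ ^ γ ≤ 1 + ‖ξ‖ ^ ⌈γ⌉₊ := fun ξ => by
    rcases le_total ‖ξ‖ 1 with h | h
    · exact (Real.rpow_le_one (norm_nonneg _) h hγ.le).trans (by simp)
    · rw [← Real.rpow_natCast]
      exact (Real.rpow_le_rpow_of_exponent_le h (Nat.le_ceil γ)).trans (by simp)
  refine hdom.mono' hcont.aestronglyMeasurable (.of_forall fun ξ => ?_)
  rw [fracMultiplier, norm_mul, Complex.norm_real, Real.norm_of_nonneg (by positivity),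
    Real.mul_rpow (by positivity) (norm_nonneg ξ), mul_assoc, ← one_add_mul]
  gcongr
  exact hpow ξ

lemma fourierInv_sub {f g : V → ℂ} (hf : Integrable f) (hg : Integrable g) :
    𝓕⁻ (f - g) = 𝓕⁻ f - 𝓕⁻ g := by
  ext x
  simp only [Real.fourierInv_eq, Pi.sub_apply, smul_sub]
  exact integral_sub (integrable_fourierChar_smul hf x) (integrable_fourierChar_smul hg x)

end FourierMultiplier

variable {n m : ℕ}

lemma finrank_space (n m : ℕ) : (Module.finrank ℝ (Space n m) : ℝ) = n + m := by
  rw [finrank_euclideanSpace, Fintype.card_sum, Fintype.card_fin, Fintype.card_fin, Nat.cast_add]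

/-- The Fourier transform of a real test function, as a Schwartz function. -/
def IsTest.fourier {φ : Space n m → ℝ} (hφ : IsTest φ) : SchwartzMap (Space n m) ℂ :=
  𝓕 (HasCompactSupport.toSchwartzMap (f := fun X => (φ X : ℂ))
    (hφ.2.comp_left Complex.ofReal_zero) (Complex.ofRealCLM.contDiff.comp hφ.1))

lemma IsTest.fourierInv_fourier {φ : Space n m → ℝ} (hφ : IsTest φ) (X : Space n m) :
    𝓕⁻ (⇑hφ.fourier) X = φ X := by
  rw [← SchwartzMap.fourierInv_coe, IsTest.fourier, FourierTransform.fourierInv_fourier_eq]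
  rfl

lemma IsTest.fourier_sub {φ ψ : Space n m → ℝ} (hφ : IsTest φ) (hψ : IsTest ψ) :
    (hφ.sub hψ).fourier = hφ.fourier - hψ.fourier := by
  refine Eq.trans ?_ (map_sub (FourierTransform.fourierCLM ℂ (SchwartzMap (Space n m) ℂ)) _ _)
  rw [FourierTransform.fourierCLM_apply]
  refine congrArg 𝓕 (SchwartzMap.ext fun X => ?_)
  exact Complex.ofReal_sub (φ X) (ψ X)

lemma fracLaplacian_eq {φ : Space n m → ℝ} (hφ : IsTest φ) (γ : ℝ) :
    fracLaplacian γ φ = fun X => (𝓕⁻ (fracMultiplier γ hφ.fourier) X).re := rfl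

lemma continuous_fracLaplacian {γ : ℝ} (hγ : 0 < γ) {φ : Space n m → ℝ} (hφ : IsTest φ) :
    Continuous (fracLaplacian γ φ) := by
  rw [fracLaplacian_eq hφ]
  exact Complex.continuous_re.comp (continuous_fourierInv (integrable_fracMultiplier hγ _))

lemma fracLaplacian_sub {γ : ℝ} (hγ : 0 < γ) {φ ψ : Space n m → ℝ} (hφ : IsTest φ)
    (hψ : IsTest ψ) :
    fracLaplacian γ (φ - ψ) = fracLaplacian γ φ - fracLaplacian γ ψ := by
  have hcoe : ⇑(hφ.fourier - hψ.fourier) = ⇑hφ.fourier - ⇑hψ.fourier := rfl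
  rw [fracLaplacian_eq (hφ.sub hψ), hφ.fourier_sub hψ, hcoe, fracMultiplier_sub,
    fourierInv_sub (integrable_fracMultiplier hγ _) (integrable_fracMultiplier hγ _)]
  rfl

lemma exists_enorm_le_rieszPotential_fracLaplacian {γ : ℝ} (hγ : 0 < γ) (hγ' : γ < n + m) :
    ∃ C : ℝ≥0∞, C ≠ ⊤ ∧ ∀ φ : Space n m → ℝ, IsTest φ → ∀ X,
      ‖φ X‖ₑ ≤ C * rieszPotential volume (n + m - γ) (fun Y => ‖fracLaplacian γ φ Y‖ₑ) X := by
  rw [← finrank_space] at hγ' ⊢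
  obtain ⟨C, hC, h⟩ := exists_enorm_fourierInv_le_rieszPotential hγ hγ'
  refine ⟨C, hC, fun φ hφ X => ?_⟩
  have hφX := h _ hφ.fourier.integrable (integrable_fracMultiplier hγ _) X
  rwa [hφ.fourierInv_fourier, Complex.ofReal_re] at hφX

lemma enorm_gradient {V : Type*} [NormedAddCommGroup V] [InnerProductSpace ℝ V] [CompleteSpace V]
    (φ : V → ℝ) (X : V) : ‖gradient φ X‖ₑ = ‖fderiv ℝ φ X‖ₑ := by
  rw [gradient, LinearIsometryEquiv.enorm_map]

lemma continuous_gradient {φ : Space n m → ℝ} (hφ : IsTest φ) : Continuous (gradient φ) :=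
  (InnerProductSpace.toDual ℝ _).symm.continuous.comp (hφ.1.continuous_fderiv (by simp))

lemma gradient_sub {φ ψ : Space n m → ℝ} (hφ : IsTest φ) (hψ : IsTest ψ) :
    gradient (φ - ψ) = gradient φ - gradient ψ := by
  ext1 X
  simp only [gradient, Pi.sub_apply]
  rw [fderiv_sub ((hφ.1.differentiable (by simp)) X) ((hψ.1.differentiable (by simp)) X), map_sub]

lemma exists_enorm_le_rieszPotential_gradient (hm : 0 < m) :
    ∃ C : ℝ≥0∞, C ≠ ⊤ ∧ ∀ φ : Space n m → ℝ, IsTest φ → ∀ X,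
      ‖φ X‖ₑ ≤ C * rieszPotential volume (n + m - 1) (fun Y => ‖gradient φ Y‖ₑ) X := by
  have : Nonempty (Fin m) := ⟨⟨0, hm⟩⟩
  have hσ : (volume : Measure (Space n m)).toSphere Set.univ ≠ 0 :=
    Measure.measure_univ_ne_zero.2 (Measure.toSphere_ne_zero _)
  refine ⟨((volume : Measure (Space n m)).toSphere Set.univ)⁻¹, by simpa using hσ,
    fun φ hφ X => ?_⟩
  rw [← ENNReal.mul_le_iff_le_inv hσ (measure_ne_top _ _), ← finrank_space]
  simp_rw [enorm_gradient]
  exact toSphere_mul_enorm_le_rieszPotential_fderiv volume (hφ.1.of_le (by simp)) hφ.2 X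

end Operators

lemma pos_of_lt_div {m : ℕ} {p q α β : ℝ} (hαβ : 0 ≤ α + β)
    (hα : α < m / Real.conjExponent p) (hβ : β < m / q) : 0 < m := by
  rcases Nat.eq_zero_or_pos m with rfl | h
  · simp only [Nat.cast_zero, zero_div] at hα hβ
    linarith
  · exact h

lemma one_lt_add_of_scaling {n m : ℕ} {p q α β : ℝ} (hp : 1 < p)
    (hαβ : 0 ≤ α + β) (hα : α < m / Real.conjExponent p) (hβ : β < m / q)
    (hdeg : 1 / q = 1 / p + (α + β - 1) / (n + m)) : (1 : ℝ) < n + m := by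
  have hm := pos_of_lt_div hαβ hα hβ
  by_contra! hle
  have hnm : n + m ≤ 1 := by exact_mod_cast hle
  obtain rfl : n = 0 := by omega
  obtain rfl : m = 1 := by omega
  have hconj : 1 / Real.conjExponent p = 1 - 1 / p := by
    have := (Real.HolderConjugate.conjExponent hp).one_sub_inv
    simp only [one_div, this]
  simp only [Nat.cast_zero, Nat.cast_one, zero_add, div_one] at hα hβ hdeg
  linarith

end PartialWeight

end

theorem theorem1p12 (n m : ℕ) (p q α β : ℝ) (hp : 1 < p) (hpq : p ≤ q) (hαβ : 0 ≤ α + β)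
    (hα : α < (m : ℝ) / Real.conjExponent p) (hβ : β < (m : ℝ) / q) :
    (∀ γ : ℝ, 0 < γ → γ < (n : ℝ) + m → 1 / q = 1 / p + (α + β - γ) / ((n : ℝ) + m) →
      ∃ S : ℝ, 0 < S ∧
        (∀ u f : PartialWeight.Space n m → ℝ, PartialWeight.InFracSobolev γ α p u f →
          eLpNorm (fun X => PartialWeight.weight (-β) X * u X) (ENNReal.ofReal q) volume ≤
            ENNReal.ofReal S *
              eLpNorm (fun X => PartialWeight.weight α X * f X) (ENNReal.ofReal p) volume) ∧
        (∀ φ : ℕ → PartialWeight.Space n m → ℝ,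
          PartialWeight.IsCauchySeq (PartialWeight.fracLaplacian γ) α p φ →
          ∃ u f : PartialWeight.Space n m → ℝ, PartialWeight.InFracSobolev γ α p u f ∧
            Tendsto (fun k => PartialWeight.wdist α p (PartialWeight.fracLaplacian γ (φ k)) f)
              atTop (𝓝 0) ∧
            Tendsto (fun k => PartialWeight.wdist (-β) q (φ k) u) atTop (𝓝 0))) ∧
    (1 / q = 1 / p + (α + β - 1) / ((n : ℝ) + m) →
      ∃ S : ℝ, 0 < S ∧
        (∀ (u : PartialWeight.Space n m → ℝ)
            (G : PartialWeight.Space n m → PartialWeight.Space n m),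
          PartialWeight.InGradSobolev α p u G →
          eLpNorm (fun X => PartialWeight.weight (-β) X * u X) (ENNReal.ofReal q) volume ≤
            ENNReal.ofReal S *
              eLpNorm (fun X => PartialWeight.weight α X • G X) (ENNReal.ofReal p) volume) ∧
        (∀ φ : ℕ → PartialWeight.Space n m → ℝ,
          PartialWeight.IsCauchySeq gradient α p φ →
          ∃ (u : PartialWeight.Space n m → ℝ)
            (G : PartialWeight.Space n m → PartialWeight.Space n m),
            PartialWeight.InGradSobolev α p u G ∧
            Tendsto (fun k => PartialWeight.wdist α p (gradient (φ k)) G) atTop (𝓝 0) ∧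
            Tendsto (fun k => PartialWeight.wdist (-β) q (φ k) u) atTop (𝓝 0))) := by
  have hm := PartialWeight.pos_of_lt_div hαβ hα hβ
  refine ⟨fun γ hγ hγ' hdeg => ?_, fun hdeg => ?_⟩
  · obtain ⟨C, hC, hpot⟩ :=
      PartialWeight.exists_enorm_le_rieszPotential_fracLaplacian (n := n) (m := m) hγ hγ'
    exact PartialWeight.exists_sobolev_constant hm hp hpq hαβ hα hβ hγ hγ' hdeg
      (fun φ hφ => PartialWeight.continuous_fracLaplacian hγ hφ)
      (fun φ ψ hφ hψ => PartialWeight.fracLaplacian_sub hγ hφ hψ) hC hpot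
  · obtain ⟨C, hC, hpot⟩ := PartialWeight.exists_enorm_le_rieszPotential_gradient (n := n) hm
    exact PartialWeight.exists_sobolev_constant hm hp hpq hαβ hα hβ one_pos
      (PartialWeight.one_lt_add_of_scaling hp hαβ hα hβ hdeg) hdeg
      (fun φ hφ => PartialWeight.continuous_gradient hφ)
      (fun φ ψ hφ hψ => PartialWeight.gradient_sub hφ hψ) hC hpot
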